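/- Let $V:\mathbb N=\{1,2,\dots\}\to\mathbb R$ satisfy $\sum_{n=1}^\infty |V(n)|<\infty$. Let $H$ be the operator in $L^2(0,\infty)$ (Dirichlet condition at $x=0$) associated with the quadratic form $$\int_0^\infty |u'|^2\,dx+\sum_{n=1}^\infty V(n)|u(n)|^2,\qquad u\in W^{1,2}_0(0,\infty),$$ and let $\tilde H$ be the operator in $L^2(\mathbb R)$ associated with the quadratic form $$\int_{\mathbb R} |u'|^2\,dx+\sum_{n=1}^\infty V(n)|u(n)|^2,\qquad u\in W^{1,2}(\mathbb R).$$ Here $u(n)$ is the value at $n$ of the continuous representative of $u$. Then the negative eigenvalues $E_j$ of $H$, counted with multiplicity, satisfy $$\sum_j |E_j|^{1/2}\le \frac12\sum_{n=1}^\infty |V(n)|,$$ and the negative eigenvalues of $\tilde H$, counted with multiplicity, satisfy the same inequality. -/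

import Mathlib

open MeasureTheory
open scoped ENNReal ContDiff ComplexConjugate

noncomputable section

namespace DeltaSchrodinger

/-- The complex Hilbert space `L²(Ω)` for `Ω ⊆ ℝ`, with Lebesgue measure. -/
abbrev L2 (Ω : Set ℝ) : Type := Lp ℂ 2 (volume.restrict Ω)

/-- `φ ∈ C_c^∞(Ω)`. -/
structure IsTest (Ω : Set ℝ) (φ : ℝ → ℂ) : Prop where
  smooth : ContDiff ℝ ∞ φ
  compact : HasCompactSupport φ
  subset : tsupport φ ⊆ Ω

theorem IsTest.memLp {Ω : Set ℝ} {φ : ℝ → ℂ} (h : IsTest Ω φ) :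
    MemLp φ 2 (volume.restrict Ω) :=
  (h.smooth.continuous.memLp_of_hasCompactSupport h.compact).restrict Ω

theorem IsTest.memLp_deriv {Ω : Set ℝ} {φ : ℝ → ℂ} (h : IsTest Ω φ) :
    MemLp (deriv φ) 2 (volume.restrict Ω) :=
  ((h.smooth.continuous_deriv (by simp)).memLp_of_hasCompactSupport h.compact.deriv).restrict Ω

theorem integrable_mul_of_memLp {Ω : Set ℝ} {φ : ℝ → ℂ}
    (h : MemLp φ 2 (volume.restrict Ω)) (u : L2 Ω) :
    Integrable (fun x => u x * φ x) (volume.restrict Ω) :=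
  (Lp.memLp u).integrable_mul h

/-- The Sobolev space `W^{1,2}(Ω)`, each element `u` being recorded together with its weak
derivative, as the pair `(u, u')`. -/
def sobolevW (Ω : Set ℝ) : Submodule ℂ (L2 Ω × L2 Ω) where
  carrier := {p | ∀ φ : ℝ → ℂ, IsTest Ω φ →
    ∫ x in Ω, p.1 x * deriv φ x = -∫ x in Ω, p.2 x * φ x}
  zero_mem' := by
    intro φ _
    have h : ∀ ψ : ℝ → ℂ, ∫ x in Ω, (0 : L2 Ω) x * ψ x = 0 := by
      intro ψ
      apply integral_eq_zero_of_ae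
      filter_upwards [Lp.coeFn_zero ℂ 2 (volume.restrict Ω)] with x hx
      rw [hx]
      simp
    simp only [Prod.fst_zero, Prod.snd_zero, h, neg_zero]
  add_mem' := by
    intro p q hp hq φ hφ
    have h : ∀ (u v : L2 Ω) (ψ : ℝ → ℂ), MemLp ψ 2 (volume.restrict Ω) →
        ∫ x in Ω, (u + v : L2 Ω) x * ψ x = (∫ x in Ω, u x * ψ x) + ∫ x in Ω, v x * ψ x := by
      intro u v ψ hψ
      rw [← integral_add (integrable_mul_of_memLp hψ u) (integrable_mul_of_memLp hψ v)]
      apply integral_congr_ae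
      filter_upwards [Lp.coeFn_add u v] with x hx
      rw [hx, Pi.add_apply, add_mul]
    rw [Prod.fst_add, Prod.snd_add, h _ _ _ hφ.memLp_deriv, h _ _ _ hφ.memLp, hp φ hφ, hq φ hφ]
    ring
  smul_mem' := by
    intro c p hp φ hφ
    have h : ∀ (u : L2 Ω) (ψ : ℝ → ℂ),
        ∫ x in Ω, (c • u : L2 Ω) x * ψ x = c * ∫ x in Ω, u x * ψ x := by
      intro u ψ
      rw [← integral_const_mul]
      apply integral_congr_ae
      filter_upwards [Lp.coeFn_smul c u] with x hx
      rw [hx, Pi.smul_apply, smul_eq_mul, mul_assoc]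
    rw [Prod.smul_fst, Prod.smul_snd, h, h, hp φ hφ]
    ring

/-- The pairs `(φ, φ')` with `φ ∈ C_c^∞(Ω)`. -/
def testPairs (Ω : Set ℝ) : Submodule ℂ (L2 Ω × L2 Ω) where
  carrier := {p | ∃ φ : ℝ → ℂ, IsTest Ω φ ∧
    p.1 =ᵐ[volume.restrict Ω] φ ∧ p.2 =ᵐ[volume.restrict Ω] deriv φ}
  zero_mem' := by
    refine ⟨0, ⟨contDiff_const, HasCompactSupport.zero, by simp [tsupport]⟩,
      Lp.coeFn_zero _ _ _, ?_⟩
    filter_upwards [Lp.coeFn_zero ℂ 2 (volume.restrict Ω)] with x hx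
    rw [Prod.snd_zero, hx]
    simp
  add_mem' := by
    rintro p q ⟨φ, hφ, hp1, hp2⟩ ⟨ψ, hψ, hq1, hq2⟩
    refine ⟨φ + ψ, ⟨hφ.smooth.add hψ.smooth, hφ.compact.add hψ.compact,
      (tsupport_add φ ψ).trans (Set.union_subset hφ.subset hψ.subset)⟩, ?_, ?_⟩
    · exact (Lp.coeFn_add _ _).trans (hp1.add hq1)
    · refine (Lp.coeFn_add _ _).trans ((hp2.add hq2).trans ?_)
      filter_upwards with x
      rw [deriv_add (hφ.smooth.differentiable (by simp) x)
        (hψ.smooth.differentiable (by simp) x), Pi.add_apply]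
  smul_mem' := by
    rintro c p ⟨φ, hφ, hp1, hp2⟩
    refine ⟨c • φ, ⟨contDiff_const.smul hφ.smooth, hφ.compact.smul_left (f := fun _ => c),
      (closure_mono (Function.support_const_smul_subset c φ)).trans hφ.subset⟩, ?_, ?_⟩
    · exact (Lp.coeFn_smul _ _).trans (hp1.const_smul c)
    · refine (Lp.coeFn_smul _ _).trans ((hp2.const_smul c).trans ?_)
      filter_upwards with x
      rw [deriv_const_smul c (hφ.smooth.differentiable (by simp) x), Pi.smul_apply]

/-- The Sobolev space `W_0^{1,2}(Ω)`, the closure of `C_c^∞(Ω)` in the topology of `W^{1,2}(Ω)`;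
again `u` is recorded as `(u, u')`. -/
def sobolevW0 (Ω : Set ℝ) : Submodule ℂ (L2 Ω × L2 Ω) :=
  (testPairs Ω).topologicalClosure

open Classical in
/-- The representative of `u` that is continuous on `Ω`. For open `Ω` its values on `Ω` do not
depend on the choice, and it exists for every `u` in `W^{1,2}(Ω)`, the only case of interest. -/
def contRep (Ω : Set ℝ) (u : L2 Ω) : ℝ → ℂ :=
  if h : ∃ v : ℝ → ℂ, ContinuousOn v Ω ∧ v =ᵐ[volume.restrict Ω] u then h.choose else 0

/-- The sesquilinear form `∫_Ω conj(φ') u' dx + ∑_{n ≥ 1} V(n) conj(φ(n)) u(n)`, at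
`p = (φ, φ')` and `q = (u, u')`. -/
def form (Ω : Set ℝ) (V : ℕ+ → ℝ) (p q : L2 Ω × L2 Ω) : ℂ :=
  inner ℂ p.2 q.2 +
    ∑' n : ℕ+, (V n : ℂ) * (conj (contRep Ω p.1 (n : ℕ)) * contRep Ω q.1 (n : ℕ))

/-- The graph of the operator in `L²(Ω)` that belongs to the form with domain `Q`:
`u` is in its domain and is mapped to `f` iff `u ∈ Q` and `form φ u = ⟪φ, f⟫` for all `φ ∈ Q`. -/
def formOperator (Ω : Set ℝ) (Q : Submodule ℂ (L2 Ω × L2 Ω)) (V : ℕ+ → ℝ) :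
    Set (L2 Ω × L2 Ω) :=
  {z | ∃ g : L2 Ω, (z.1, g) ∈ Q ∧ ∀ p ∈ Q, form Ω V p (z.1, g) = inner ℂ p.1 z.2}

/-- The operator `H = -d²/dx² + ∑_{n ≥ 1} V(n) δ(x - n)` in `L²(0, ∞)` with the Dirichlet
condition at `0`, given by its graph. -/
def halfLineOperator (V : ℕ+ → ℝ) : Set (L2 (Set.Ioi 0) × L2 (Set.Ioi 0)) :=
  formOperator (Set.Ioi 0) (sobolevW0 (Set.Ioi 0)) V

/-- The operator `H̃ = -d²/dx² + ∑_{n ≥ 1} V(n) δ(x - n)` in `L²(ℝ)`, given by its graph. -/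
def lineOperator (V : ℕ+ → ℝ) : Set (L2 Set.univ × L2 Set.univ) :=
  formOperator Set.univ (sobolevW Set.univ) V

section Eigenvalues

variable {X : Type} [AddCommGroup X] [Module ℂ X]

/-- The negative eigenvalues of an operator `T` given by its graph. -/
def negEigenvalues (T : Set (X × X)) : Set ℝ :=
  {E | E < 0 ∧ ∃ u : X, u ≠ 0 ∧ (u, (E : ℂ) • u) ∈ T}

/-- The multiplicity of `E`: the dimension of the space of all `u` with `T u = E u` (for a linear
operator these `u` already form a subspace, so that taking the span adds nothing). -/
def multiplicity (T : Set (X × X)) (E : ℝ) : ℕ∞ :=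
  Cardinal.toENat (Module.rank ℂ (Submodule.span ℂ {u : X | (u, (E : ℂ) • u) ∈ T}))

/-- `∑_j |E_j|^{1/2}` over the negative eigenvalues of `T`, counted with multiplicity. -/
def sumSqrtNegEigenvalues (T : Set (X × X)) : ℝ≥0∞ :=
  ∑' E : negEigenvalues T, (multiplicity T (E : ℝ) : ℝ≥0∞) * ENNReal.ofReal √|(E : ℝ)|

end Eigenvalues

end DeltaSchrodinger

end

/-! This is the Hundertmark–Lieb–Thomas argument, run on quadratic forms of finite matrices. Take
finitely many negative eigenvalues -κ_i² with orthonormal eigenfunctions, and let u be a combination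
of those with κ_i ≥ μ > 0. The eigenvalue equations give ‖u'‖² + μ²‖u‖² ≤ ∑ |V(n)| |u(n)|²
(`energy_le`). In the other direction, u(y) = ∫_{x ≤ y} e^{μ(x-y)} (u' + μu)(x) dx, its mirror image
and Cauchy–Schwarz bound |∑ c_n u(n)|² by ‖u'‖² + μ²‖u‖² times the quadratic form of the Green
function e^{-μ|m-n|}/(2μ) (`IsWeakDeriv.exists_continuous`). Only the full-line Green function
occurs: an element of W_0^{1,2}(0,∞) extended by zero is weakly differentiable on ℝ, so both
operators are treated alike through `IsRegular`. With w_n = √|V(n)|, the two bounds say that on the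
vector (w_n u(n)) the form of K_r = (w_m w_n r^{|m-n|}), r = e^{-μ}, is at least 2μ times the
squared norm, up to an error from truncation to N sites (`evalMap_ne_zero_and_le`).

Each eigenvalue comes with its own kernel. The kernels are comparable because the largest sum of the
form of K_r over k orthonormal vectors increases with r: K_r is the Schur product of K_t with
(r/t)^{|m-n|}, which is an average of conjugations by diagonal sign matrices (`exists_sign_le`).
Adding eigenvalues in order of decreasing κ_i, one orthonormal vector at a time, and raising r
accordingly (`exists_orthonormal_sum_le`), one ends at r = 1, where the kernel has rank one and
trace ∑ w_n². Letting N → ∞ gives 2 ∑ κ_i ≤ ∑ |V(n)|. -/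

noncomputable section

namespace DeltaSchrodinger

/-! ### Matrix inequalities for the kernels w_m w_n r^|m-n| -/

section Kernel

variable {N : ℕ}

/-- Collapsing the site k into k+1 loses one factor ρ exactly when the bond between k and k+1
separates m from n. The prefactor is ρ when the two signs differ and 1 when they agree. -/
theorem pow_dist_max_succ (ρ : ℝ) (k m n : ℕ) :
    ρ ^ Nat.dist (max m k) (max n k) =
      ((1 + ρ) / 2 + (1 - ρ) / 2 * ((if m ≤ k then -1 else 1) * (if n ≤ k then -1 else 1))) *
        ρ ^ Nat.dist (max m (k + 1)) (max n (k + 1)) := by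
  by_cases hm : m ≤ k <;> by_cases hn : n ≤ k
  · have h1 : Nat.dist (max m k) (max n k) = 0 := by unfold Nat.dist; omega
    have h2 : Nat.dist (max m (k + 1)) (max n (k + 1)) = 0 := by unfold Nat.dist; omega
    rw [h1, h2]; simp [hm, hn]; ring
  · have h1 : Nat.dist (max m k) (max n k) = Nat.dist (max m (k + 1)) (max n (k + 1)) + 1 := by
      unfold Nat.dist; omega
    rw [h1]; simp [hm, hn]; ring
  · have h1 : Nat.dist (max m k) (max n k) = Nat.dist (max m (k + 1)) (max n (k + 1)) + 1 := by
      unfold Nat.dist; omega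
    rw [h1]; simp [hm, hn]; ring
  · have h1 : Nat.dist (max m k) (max n k) = Nat.dist (max m (k + 1)) (max n (k + 1)) := by
      unfold Nat.dist; omega
    rw [h1]; simp [hm, hn]; ring

/-- Schur multiplication by `ρ ^ |m - n|` is an average of conjugations by diagonal sign
matrices. Here the average has been carried out over the sites below `k` only. -/
theorem exists_sign_le_aux (M : Fin N → Fin N → ℝ) {ρ : ℝ} (h0 : 0 ≤ ρ) (h1 : ρ ≤ 1) (k : ℕ) :
    ∃ s : Fin N → ℝ, (∀ n, s n = 1 ∨ s n = -1) ∧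
      ∑ m, ∑ n, M m n * ρ ^ Nat.dist m n ≤
        ∑ m, ∑ n, M m n * (s m * s n) * ρ ^ Nat.dist (max m k) (max n k) := by
  induction k with
  | zero => exact ⟨fun _ => 1, fun _ => Or.inl rfl, by simp⟩
  | succ k ih =>
    obtain ⟨s, hs, hle⟩ := ih
    set σ : Fin N → ℝ := fun m => if (m : ℕ) ≤ k then -1 else 1 with hσ
    set X : (Fin N → ℝ) → ℝ := fun s =>
      ∑ m : Fin N, ∑ n : Fin N, M m n * (s m * s n) *
        ρ ^ Nat.dist (max m (k + 1)) (max n (k + 1)) with hX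
    have key : ∑ m : Fin N, ∑ n : Fin N, M m n * (s m * s n) * ρ ^ Nat.dist (max m k) (max n k) =
        (1 + ρ) / 2 * X s + (1 - ρ) / 2 * X (fun m => s m * σ m) := by
      simp only [hX, Finset.mul_sum, ← Finset.sum_add_distrib]
      refine Finset.sum_congr rfl fun m _ => Finset.sum_congr rfl fun n _ => ?_
      rw [pow_dist_max_succ ρ k m n]
      simp only [hσ]
      ring
    rw [key] at hle
    -- The weights (1+ρ)/2 and (1-ρ)/2 are nonnegative with sum 1, so the better of the two sign
    -- patterns dominates the average.
    by_cases hc : X (fun m => s m * σ m) ≤ X s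
    · exact ⟨s, hs, hle.trans (by nlinarith)⟩
    · refine ⟨fun m => s m * σ m, fun n => ?_, hle.trans ?_⟩
      · rcases hs n with h | h <;> by_cases hn : (n : ℕ) ≤ k <;> simp [hσ, h, hn]
      · change _ ≤ X (fun m => s m * σ m)
        nlinarith

theorem exists_sign_le (M : Fin N → Fin N → ℝ) {ρ : ℝ} (h0 : 0 ≤ ρ) (h1 : ρ ≤ 1) :
    ∃ s : Fin N → ℝ, (∀ n, s n = 1 ∨ s n = -1) ∧
      ∑ m, ∑ n, M m n * ρ ^ Nat.dist m n ≤ ∑ m, ∑ n, M m n * (s m * s n) := by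
  -- At k = N all sites have collapsed to a single one and every exponent is zero.
  obtain ⟨s, hs, h⟩ := exists_sign_le_aux M h0 h1 N
  refine ⟨s, hs, h.trans_eq ?_⟩
  refine Finset.sum_congr rfl fun m _ => Finset.sum_congr rfl fun n _ => ?_
  rw [max_eq_right m.2.le, max_eq_right n.2.le, Nat.dist_self, pow_zero, mul_one]

/-- The quadratic form of the matrix `w m * w n * r ^ |m - n|`. -/
def kernelForm (w : Fin N → ℝ) (r : ℝ) (c : EuclideanSpace ℂ (Fin N)) : ℝ :=
  ∑ m, ∑ n, w m * w n * r ^ Nat.dist m n * (conj (c m) * c n).re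

theorem kernelForm_smul (w : Fin N → ℝ) (r x : ℝ) (c : EuclideanSpace ℂ (Fin N)) :
    kernelForm w r ((x : ℂ) • c) = x ^ 2 * kernelForm w r c := by
  simp only [kernelForm, Finset.mul_sum]
  refine Finset.sum_congr rfl fun m _ => Finset.sum_congr rfl fun n _ => ?_
  simp
  ring

theorem kernelForm_one (w : Fin N → ℝ) (c : EuclideanSpace ℂ (Fin N)) :
    kernelForm w 1 c =
      ‖(inner ℂ c (WithLp.toLp 2 fun n => (w n : ℂ)) : ℂ)‖ ^ 2 := by
  have h : (inner ℂ c (WithLp.toLp 2 fun n => (w n : ℂ)) : ℂ) = ∑ m, (w m : ℂ) * conj (c m) := by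
    simp [PiLp.inner_apply]
  have h2 : ((‖(inner ℂ c (WithLp.toLp 2 fun n => (w n : ℂ)) : ℂ)‖ ^ 2 : ℝ) : ℂ) =
      ∑ m, ∑ n, (w m : ℂ) * w n * (conj (c m) * c n) := by
    push_cast
    rw [← Complex.mul_conj', h, map_sum, Finset.sum_mul_sum]
    refine Finset.sum_congr rfl fun m _ => Finset.sum_congr rfl fun n _ => ?_
    simp
    ring
  have h3 := congrArg Complex.re h2
  rw [Complex.ofReal_re] at h3
  rw [h3, kernelForm]
  simp only [Complex.re_sum]
  refine Finset.sum_congr rfl fun m _ => Finset.sum_congr rfl fun n _ => ?_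
  rw [one_pow, mul_one, ← Complex.ofReal_mul, Complex.re_ofReal_mul]

/-- The largest possible sum of `kernelForm w r` over an orthonormal family of given size is
monotone in `r`. -/
theorem exists_orthonormal_sum_kernelForm_le (w : Fin N → ℝ) {r t : ℝ} (h0 : 0 ≤ r) (hrt : r ≤ t)
    {k : ℕ} {f : Fin k → EuclideanSpace ℂ (Fin N)} (hf : Orthonormal ℂ f) :
    ∃ f' : Fin k → EuclideanSpace ℂ (Fin N), Orthonormal ℂ f' ∧
      ∑ j, kernelForm w r (f j) ≤ ∑ j, kernelForm w t (f' j) := by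
  rcases hrt.eq_or_lt with rfl | hlt
  · exact ⟨f, hf, le_rfl⟩
  have ht : 0 < t := h0.trans_lt hlt
  -- The sum over j sits inside the matrix, so that one sign pattern serves the whole family; a
  -- diagonal sign matrix is unitary and keeps it orthonormal.
  obtain ⟨s, hs, hle⟩ := exists_sign_le
    (fun m n : Fin N => ∑ j, w m * w n * t ^ Nat.dist m n * (conj (f j m) * f j n).re)
    (div_nonneg h0 ht.le) ((div_le_one ht).2 hrt)
  have hss : ∀ n, (s n : ℂ) * s n = 1 := fun n => by
    rcases hs n with h | h <;> simp [h]
  refine ⟨fun j => WithLp.toLp 2 fun n => (s n : ℂ) * f j n, ?_, ?_⟩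
  · rw [orthonormal_iff_ite] at hf ⊢
    intro i j
    rw [← hf i j, PiLp.inner_apply, PiLp.inner_apply]
    refine Finset.sum_congr rfl fun n _ => ?_
    simp only [RCLike.inner_apply, map_mul, Complex.conj_ofReal]
    linear_combination (f j n * conj (f i n)) * hss n
  · have e1 : ∑ j, kernelForm w r (f j) = ∑ m : Fin N, ∑ n : Fin N,
        (∑ j, w m * w n * t ^ Nat.dist m n * (conj (f j m) * f j n).re) *
          (r / t) ^ Nat.dist m n := by
      simp only [kernelForm]
      rw [Finset.sum_comm]
      refine Finset.sum_congr rfl fun m _ => ?_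
      rw [Finset.sum_comm]
      refine Finset.sum_congr rfl fun n _ => ?_
      rw [Finset.sum_mul]
      refine Finset.sum_congr rfl fun j _ => ?_
      rw [div_pow]
      field_simp
    have e2 : ∑ j, kernelForm w t (WithLp.toLp 2 fun n => (s n : ℂ) * f j n) =
        ∑ m : Fin N, ∑ n : Fin N,
        (∑ j, w m * w n * t ^ Nat.dist m n * (conj (f j m) * f j n).re) * (s m * s n) := by
      simp only [kernelForm]
      rw [Finset.sum_comm]
      refine Finset.sum_congr rfl fun m _ => ?_
      rw [Finset.sum_comm]
      refine Finset.sum_congr rfl fun n _ => ?_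
      rw [Finset.sum_mul]
      refine Finset.sum_congr rfl fun j _ => ?_
      have : conj ((s m : ℂ) * f j m) * ((s n : ℂ) * f j n) =
          ((s m * s n : ℝ) : ℂ) * (conj (f j m) * f j n) := by
        simp
        ring
      rw [this, Complex.re_ofReal_mul]
      ring
    rw [e1, e2]
    exact hle

theorem orthonormal_fin_cons {E : Type*} [NormedAddCommGroup E] [InnerProductSpace ℂ E] {k : ℕ}
    {f : Fin k → E} (hf : Orthonormal ℂ f) {c : E} (hc : ‖c‖ = 1) (h : ∀ i, inner ℂ (f i) c = 0) :
    Orthonormal ℂ (Fin.cons c f : Fin (k + 1) → E) := by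
  rw [orthonormal_iff_ite] at hf ⊢
  intro i j
  refine Fin.cases ?_ (fun i => ?_) i <;> refine Fin.cases ?_ (fun j => ?_) j
  · simp [inner_self_eq_norm_sq_to_K, hc]
  · simpa [(Fin.succ_ne_zero j).symm] using inner_eq_zero_symm.1 (h j)
  · simpa [Fin.succ_ne_zero i] using h i
  · simpa using hf i j

/-- The combinatorial core of the Hundertmark-Lieb-Thomas argument. -/
theorem exists_orthonormal_sum_le {ι : Type*} [Fintype ι] [DecidableEq ι] (w : Fin N → ℝ)
    (μ b : ι → ℝ) (T : (ι → ℂ) →ₗ[ℂ] EuclideanSpace ℂ (Fin N))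
    (hT : ∀ i, ∀ a : ι → ℂ, a ≠ 0 → (∀ j, a j ≠ 0 → μ i ≤ μ j) →
      T a ≠ 0 ∧ b i * ‖T a‖ ^ 2 ≤ kernelForm w (Real.exp (-μ i)) (T a)) (s : Finset ι) :
    ∀ ν : ℝ, (∀ j ∈ s, ν ≤ μ j) →
      ∃ (k : ℕ) (f : Fin k → EuclideanSpace ℂ (Fin N)), k = s.card ∧ Orthonormal ℂ f ∧
        ∑ j ∈ s, b j ≤ ∑ j, kernelForm w (Real.exp (-ν)) (f j) := by
  induction s using Finset.induction_on_min_value μ with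
  | empty =>
    intro ν _
    exact ⟨0, Fin.elim0, rfl, ⟨fun i => i.elim0, fun i => i.elim0⟩, by simp⟩
  | insert a s has hmin ih =>
    intro ν hν
    -- The new index has the smallest μ, so the earlier family can be taken at the kernel of exp(-μ
    -- a), the one for which the new vector has its lower bound.
    obtain ⟨k, f, hk, hf, hle⟩ := ih (μ a) hmin
    -- Orthogonality of T x to the k old vectors and vanishing of x off `insert a s` are card ι - 1
    -- linear conditions on card ι unknowns, so some x ≠ 0 satisfies them.
    let L : (ι → ℂ) →ₗ[ℂ] (Fin k → ℂ) × ({j // j ∉ insert a s} → ℂ) :=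
      (LinearMap.pi fun i => (innerₛₗ ℂ (f i)) ∘ₗ T).prod (LinearMap.funLeft ℂ ℂ Subtype.val)
    have hker : LinearMap.ker L ≠ ⊥ := by
      apply LinearMap.ker_ne_bot_of_finrank_lt
      have h1 : Fintype.card {j // j ∉ insert a s} = Fintype.card ι - (k + 1) := by
        rw [Fintype.card_subtype_compl, Fintype.card_coe, Finset.card_insert_of_notMem has, hk]
      have h2 : k + 1 ≤ Fintype.card ι := by
        rw [hk, ← Finset.card_insert_of_notMem has]
        exact Finset.card_le_univ _
      rw [Module.finrank_prod, Module.finrank_fintype_fun_eq_card,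
        Module.finrank_fintype_fun_eq_card, Module.finrank_fintype_fun_eq_card, h1,
        Fintype.card_fin]
      omega
    obtain ⟨x, hx, hx0⟩ := Submodule.exists_mem_ne_zero_of_ne_bot hker
    rw [LinearMap.mem_ker] at hx
    have hx1 : ∀ i, inner ℂ (f i) (T x) = 0 := fun i => congrFun (congrArg Prod.fst hx) i
    have hx2 : ∀ j, j ∉ insert a s → x j = 0 := fun j hj =>
      congrFun (congrArg Prod.snd hx) ⟨j, hj⟩
    obtain ⟨hT0, hTb⟩ := hT a x hx0 fun j hj => by
      have : j ∈ insert a s := by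
        by_contra h
        exact hj (hx2 j h)
      rcases Finset.mem_insert.1 this with rfl | h
      · exact le_rfl
      · exact hmin j h
    have hn : 0 < ‖T x‖ := norm_pos_iff.2 hT0
    set c : EuclideanSpace ℂ (Fin N) := ((‖T x‖⁻¹ : ℝ) : ℂ) • T x with hc
    have hcn : ‖c‖ = 1 := by
      rw [hc, norm_smul, Complex.norm_real, Real.norm_of_nonneg (inv_nonneg.2 hn.le)]
      field_simp
    have hcQ : b a ≤ kernelForm w (Real.exp (-μ a)) c := by
      rw [hc, kernelForm_smul, inv_pow, inv_mul_eq_div, le_div_iff₀ (by positivity)]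
      exact hTb
    have hfc : Orthonormal ℂ (Fin.cons c f : Fin (k + 1) → EuclideanSpace ℂ (Fin N)) :=
      orthonormal_fin_cons hf hcn fun i => by rw [hc, inner_smul_right, hx1 i, mul_zero]
    obtain ⟨f', hf', hle'⟩ := exists_orthonormal_sum_kernelForm_le w (Real.exp_pos (-μ a)).le
      (Real.exp_le_exp.2 (neg_le_neg (hν a (Finset.mem_insert_self a s)))) hfc
    refine ⟨k + 1, f', by rw [Finset.card_insert_of_notMem has, hk], hf', le_trans ?_ hle'⟩
    rw [Finset.sum_insert has, Fin.sum_univ_succ]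
    simp only [Fin.cons_zero, Fin.cons_succ]
    exact add_le_add hcQ hle

/-- At ν = 0 the kernel is the rank-one form of the vector w, and Bessel's inequality bounds its sum
over any orthonormal family. -/
theorem sum_le_sum_sq {ι : Type*} [Fintype ι] (w : Fin N → ℝ)
    (μ b : ι → ℝ) (hμ : ∀ i, 0 ≤ μ i) (T : (ι → ℂ) →ₗ[ℂ] EuclideanSpace ℂ (Fin N))
    (hT : ∀ i, ∀ a : ι → ℂ, a ≠ 0 → (∀ j, a j ≠ 0 → μ i ≤ μ j) →
      T a ≠ 0 ∧ b i * ‖T a‖ ^ 2 ≤ kernelForm w (Real.exp (-μ i)) (T a)) :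
    ∑ i, b i ≤ ∑ n, w n ^ 2 := by
  classical
  obtain ⟨k, f, -, hf, hle⟩ :=
    exists_orthonormal_sum_le w μ b T hT Finset.univ 0 fun j _ => hμ j
  refine hle.trans ?_
  simp only [neg_zero, Real.exp_zero, kernelForm_one]
  refine (hf.sum_inner_products_le (s := Finset.univ) _).trans_eq ?_
  rw [EuclideanSpace.norm_sq_eq]
  simp

end Kernel

/-! ### Weak derivatives on the line and the exponential representation formula -/

section WeakDerivative

open Filter Set

/-- `G` is the weak derivative of `U` on `ℝ`. -/
def IsWeakDeriv (U G : ℝ → ℂ) : Prop :=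
  ∀ φ : ℝ → ℂ, IsTest univ φ → ∫ x, U x * deriv φ x = -∫ x, G x * φ x

theorem IsTest.comp_neg {φ : ℝ → ℂ} (h : IsTest univ φ) : IsTest univ fun x => φ (-x) where
  smooth := h.smooth.comp contDiff_neg
  compact := h.compact.comp_homeomorph (Homeomorph.neg ℝ)
  subset := subset_univ _

theorem IsWeakDeriv.comp_neg {U G : ℝ → ℂ} (h : IsWeakDeriv U G) :
    IsWeakDeriv (fun x => U (-x)) (fun x => -G (-x)) := by
  intro φ hφ
  have := h _ hφ.comp_neg
  rw [← integral_neg_eq_self, ← integral_neg_eq_self (fun x => G x * _)] at this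
  simp only [deriv_comp_neg, neg_neg, mul_neg, integral_neg, neg_inj] at this
  simp only [neg_mul, integral_neg, neg_neg]
  rw [this]

/-- The weak derivative can be tested against smooth functions without compact support. -/
theorem IsWeakDeriv.integral_mul_deriv {U G φ : ℝ → ℂ} (hUG : IsWeakDeriv U G)
    (hφ : ContDiff ℝ ∞ φ) (h1 : Integrable fun x => U x * φ x)
    (h2 : Integrable fun x => U x * deriv φ x) (h3 : Integrable fun x => G x * φ x) :
    ∫ x, U x * deriv φ x = -∫ x, G x * φ x := by
  let f : ContDiffBump (0 : ℝ) := ⟨1, 2, one_pos, one_lt_two⟩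
  -- Dilated cutoffs: η_n → 1 pointwise, while η_n' is O(1/n), so the extra term of the product rule
  -- disappears in the limit.
  let η : ℕ → ℝ → ℝ := fun n x => f ((n + 1 : ℝ)⁻¹ * x)
  have hη : ∀ n, ContDiff ℝ ∞ (η n) := fun n => f.contDiff.comp (contDiff_const.mul contDiff_id)
  have hη' : ∀ n x, deriv (η n) x = (n + 1 : ℝ)⁻¹ * deriv f ((n + 1 : ℝ)⁻¹ * x) := by
    intro n x
    simp only [η]
    rw [deriv_comp_mul_left, smul_eq_mul]
  have hfd : Continuous (deriv f) := (f.contDiff (n := 1)).continuous_deriv (by simp)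
  obtain ⟨M, hM⟩ := hfd.bounded_above_of_compact_support f.hasCompactSupport.deriv
  have hM0 : 0 ≤ M := (norm_nonneg _).trans (hM 0)
  have hinv : Tendsto (fun n : ℕ => ((n : ℝ) + 1)⁻¹) atTop (nhds 0) := by
    simpa only [one_div] using tendsto_one_div_add_atTop_nhds_zero_nat (𝕜 := ℝ)
  have hη1 : ∀ x, Tendsto (fun n => ((η n x : ℝ) : ℂ)) atTop (nhds 1) := by
    intro x
    have h0 : Tendsto (fun n : ℕ => ((n : ℝ) + 1)⁻¹ * x) atTop (nhds 0) := by
      simpa using hinv.mul_const x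
    have h1 : Tendsto (fun n => η n x) atTop (nhds 1) := by
      refine tendsto_const_nhds.congr' ?_
      filter_upwards [h0 (Metric.closedBall_mem_nhds 0 one_pos)] with n hn
      exact (f.one_of_mem_closedBall hn).symm
    have h2 := (Complex.continuous_ofReal.tendsto 1).comp h1
    rw [Complex.ofReal_one] at h2
    exact h2
  have hη0 : ∀ x, Tendsto (fun n => ((deriv (η n) x : ℝ) : ℂ)) atTop (nhds 0) := by
    intro x
    have h1 : Tendsto (fun n => deriv (η n) x) atTop (nhds 0) := by
      refine squeeze_zero_norm (a := fun n : ℕ => ((n : ℝ) + 1)⁻¹ * M) (fun n => ?_) ?_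
      · rw [hη', norm_mul, Real.norm_of_nonneg (by positivity)]
        gcongr
        exact hM _
      · simpa using hinv.mul_const M
    have h2 := (Complex.continuous_ofReal.tendsto 0).comp h1
    rw [Complex.ofReal_zero] at h2
    exact h2
  have hηle : ∀ n x, ‖((η n x : ℝ) : ℂ)‖ ≤ 1 := by
    intro n x
    rw [Complex.norm_real, Real.norm_of_nonneg f.nonneg]
    exact f.le_one
  have hη'le : ∀ n x, ‖((deriv (η n) x : ℝ) : ℂ)‖ ≤ M := by
    intro n x
    rw [Complex.norm_real, hη', norm_mul, Real.norm_of_nonneg (by positivity)]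
    have : ((n : ℝ) + 1)⁻¹ ≤ 1 := inv_le_one_of_one_le₀ (by linarith [n.cast_nonneg (α := ℝ)])
    calc _ ≤ 1 * M := mul_le_mul this (hM _) (norm_nonneg _) zero_le_one
      _ = M := one_mul M
  have htest : ∀ n, IsTest univ fun x => ((η n x : ℝ) : ℂ) * φ x := by
    intro n
    refine ⟨(Complex.ofRealCLM.contDiff.comp (hη n)).mul hφ, ?_, subset_univ _⟩
    have hc : HasCompactSupport (η n) :=
      f.hasCompactSupport.comp_homeomorph (Homeomorph.mulLeft₀ ((n : ℝ) + 1)⁻¹ (by positivity))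
    exact (hc.comp_left (g := fun t : ℝ => (t : ℂ)) Complex.ofReal_zero).mul_right
  have hderiv : ∀ n x, deriv (fun x => ((η n x : ℝ) : ℂ) * φ x) x =
      ((deriv (η n) x : ℝ) : ℂ) * φ x + ((η n x : ℝ) : ℂ) * deriv φ x := by
    intro n x
    have h1 : HasDerivAt (fun x => ((η n x : ℝ) : ℂ)) ((deriv (η n) x : ℝ) : ℂ) x :=
      (((hη n).differentiable (by simp) x).hasDerivAt).ofReal_comp
    exact (h1.mul (hφ.differentiable (by simp) x).hasDerivAt).deriv
  have hηc : ∀ n, Continuous fun x => ((η n x : ℝ) : ℂ) := fun n =>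
    Complex.continuous_ofReal.comp (hη n).continuous
  have hη'c : ∀ n, Continuous fun x => ((deriv (η n) x : ℝ) : ℂ) := fun n =>
    Complex.continuous_ofReal.comp ((hη n).continuous_deriv (by simp))
  have t1 : Tendsto (fun n => ∫ x, U x * deriv (fun x => ((η n x : ℝ) : ℂ) * φ x) x) atTop
      (nhds (∫ x, U x * deriv φ x)) := by
    refine tendsto_integral_of_dominated_convergence
      (fun x => M * ‖U x * φ x‖ + ‖U x * deriv φ x‖) (fun n => ?_)
      ((h1.norm.const_mul M).add h2.norm) (fun n => ae_of_all _ fun x => ?_)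
      (ae_of_all _ fun x => ?_)
    · have : (fun x => U x * deriv (fun x => ((η n x : ℝ) : ℂ) * φ x) x) = fun x =>
          ((deriv (η n) x : ℝ) : ℂ) * (U x * φ x) + ((η n x : ℝ) : ℂ) * (U x * deriv φ x) := by
        ext x
        rw [hderiv]
        ring
      rw [this]
      exact ((hη'c n).aestronglyMeasurable.mul h1.1).add
        ((hηc n).aestronglyMeasurable.mul h2.1)
    · have : U x * deriv (fun x => ((η n x : ℝ) : ℂ) * φ x) x =
          ((deriv (η n) x : ℝ) : ℂ) * (U x * φ x) + ((η n x : ℝ) : ℂ) * (U x * deriv φ x) := by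
        rw [hderiv]
        ring
      rw [this]
      refine (norm_add_le _ _).trans (add_le_add ?_ ?_)
      · rw [norm_mul]
        exact mul_le_mul_of_nonneg_right (hη'le n x) (norm_nonneg _)
      · rw [norm_mul]
        exact mul_le_of_le_one_left (norm_nonneg _) (hηle n x)
    · simp only [hderiv]
      simpa using ((((hη0 x).mul_const (φ x)).add ((hη1 x).mul_const (deriv φ x))).const_mul (U x))
  have t2 : Tendsto (fun n => ∫ x, G x * (((η n x : ℝ) : ℂ) * φ x)) atTop
      (nhds (∫ x, G x * φ x)) := by
    refine tendsto_integral_of_dominated_convergence (fun x => ‖G x * φ x‖) (fun n => ?_)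
      h3.norm (fun n => ae_of_all _ fun x => ?_) (ae_of_all _ fun x => ?_)
    · have : (fun x => G x * (((η n x : ℝ) : ℂ) * φ x)) = fun x =>
          ((η n x : ℝ) : ℂ) * (G x * φ x) := by
        ext x
        ring
      rw [this]
      exact (hηc n).aestronglyMeasurable.mul h3.1
    · rw [mul_left_comm, norm_mul]
      exact mul_le_of_le_one_left (norm_nonneg _) (hηle n x)
    · simpa using (((hη1 x).mul_const (φ x)).const_mul (G x))
  refine tendsto_nhds_unique t1 ?_
  simp only [fun n => hUG _ (htest n)]
  exact t2.neg

/-- The function `x ↦ exp (μ * (x - y))` on `(-∞, y]`, extended by zero. -/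
def expLeft (μ y : ℝ) : ℝ → ℂ :=
  (Iic y).indicator fun x => (Real.exp (μ * (x - y)) : ℂ)

theorem integrableOn_exp_mul_sub {μ : ℝ} (hμ : 0 < μ) (y c : ℝ) :
    IntegrableOn (fun x => Real.exp (μ * (x - y))) (Iic c) := by
  have := (integrableOn_exp_mul_Iic hμ c).mul_const (Real.exp (-(μ * y)))
  refine this.congr (ae_of_all _ fun x => ?_)
  simp only
  rw [← Real.exp_add]
  ring_nf

theorem memLp_indicator_exp {μ : ℝ} (hμ : 0 < μ) (y c : ℝ) :
    MemLp ((Iic c).indicator fun x => (Real.exp (μ * (x - y)) : ℂ)) 2 := by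
  rw [memLp_indicator_iff_restrict measurableSet_Iic, memLp_two_iff_integrable_sq_norm
    (Continuous.aestronglyMeasurable (by fun_prop))]
  refine (integrableOn_exp_mul_sub (mul_pos two_pos hμ) y c).congr (ae_of_all _ fun x => ?_)
  simp only [Complex.norm_real, Real.norm_eq_abs, sq_abs]
  rw [← Real.exp_nat_mul]
  push_cast
  ring_nf

theorem memLp_expLeft {μ : ℝ} (hμ : 0 < μ) (y : ℝ) : MemLp (expLeft μ y) 2 :=
  memLp_indicator_exp hμ y y

/-- The Gram matrix of the truncated exponentials is the Green function of -d²/dx² + μ². The product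
lives on x ≤ min(y,z), and 2 min(y,z) - y - z = -|y-z|. -/
theorem integral_expLeft_mul_expLeft {μ : ℝ} (hμ : 0 < μ) (y z : ℝ) :
    ∫ x, expLeft μ y x * expLeft μ z x = (Real.exp (-μ * |y - z|) / (2 * μ) : ℝ) := by
  have h : (fun x => expLeft μ y x * expLeft μ z x) = (Iic (min y z)).indicator fun x =>
      ((Real.exp (2 * μ * x) * Real.exp (-μ * (y + z)) : ℝ) : ℂ) := by
    ext x
    unfold expLeft
    rw [← inter_indicator_mul, Iic_inter_Iic]
    congr 1
    ext x
    rw [← Real.exp_add, ← Complex.ofReal_mul, ← Real.exp_add]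
    congr 2
    ring
  rw [h, integral_indicator measurableSet_Iic, integral_complex_ofReal, integral_mul_const,
    integral_exp_mul_Iic (by positivity), div_mul_eq_mul_div, ← Real.exp_add]
  congr 3
  rcases le_total y z with hyz | hyz
  · rw [min_eq_left hyz, abs_of_nonpos (by linarith)]
    ring
  · rw [min_eq_right hyz, abs_of_nonneg (by linarith)]
    ring

theorem integrable_indicator_exp_mul {μ : ℝ} (hμ : 0 < μ) (y c : ℝ) {h : ℝ → ℂ} (hh : MemLp h 2) :
    Integrable ((Iic c).indicator fun x => (Real.exp (μ * (x - y)) : ℂ) * h x) := by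
  have := (memLp_indicator_exp hμ y c).integrable_mul hh
  refine this.congr (ae_of_all _ fun x => ?_)
  by_cases hx : x ∈ Iic c <;> simp [hx]

theorem integral_expLeft_mul (μ y : ℝ) (h : ℝ → ℂ) :
    ∫ x, expLeft μ y x * h x =
      (Real.exp (-(μ * y)) : ℂ) * ∫ x in Iic y, (Real.exp (μ * x) : ℂ) * h x := by
  rw [← integral_const_mul, ← integral_indicator measurableSet_Iic]
  congr 1
  ext x
  unfold expLeft
  by_cases hx : x ∈ Iic y
  · simp only [indicator_of_mem hx]
    rw [← mul_assoc, ← Complex.ofReal_mul, ← Real.exp_add]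
    congr 3
    ring
  · simp [indicator_of_notMem hx]

theorem continuous_integral_expLeft_mul {μ : ℝ} (hμ : 0 < μ) {h : ℝ → ℂ} (hh : MemLp h 2) :
    Continuous fun y => ∫ x, expLeft μ y x * h x := by
  have hi : ∀ c, IntegrableOn (fun x => (Real.exp (μ * x) : ℂ) * h x) (Iic c) := fun c => by
    have := (integrable_indicator_iff measurableSet_Iic).1 (integrable_indicator_exp_mul hμ 0 c hh)
    simpa only [sub_zero] using this
  simp only [integral_expLeft_mul]
  refine Continuous.mul (by fun_prop) ?_
  have hp : ∀ y, ∫ x in Iic y, (Real.exp (μ * x) : ℂ) * h x =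
      (∫ x in Iic 0, (Real.exp (μ * x) : ℂ) * h x) +
        ∫ x in (0 : ℝ)..y, (Real.exp (μ * x) : ℂ) * h x := fun y => by
    rw [← intervalIntegral.integral_Iic_sub_Iic (hi 0) (hi y)]
    ring
  rw [funext hp]
  refine continuous_const.add (intervalIntegral.continuous_primitive (fun a b => ?_) 0)
  rw [intervalIntegrable_iff]
  exact (hi (max a b)).mono_set fun x hx => hx.2

theorem IsTest.exists_bound {ψ : ℝ → ℂ} (h : IsTest univ ψ) : ∃ B, ∀ x, B ≤ x → ψ x = 0 := by
  obtain ⟨B, hB⟩ := h.compact.isCompact.isBounded.bddAbove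
  refine ⟨B + 1, fun x hx => image_eq_zero_of_notMem_tsupport fun hm => ?_⟩
  linarith [hB hm]

/-- If `φ' = μ φ - ψ`, with `φ` the solution that vanishes near `∞`, then pairing `ψ` with `U` is
pairing `φ` with `U' + μ U`. -/
theorem IsWeakDeriv.integral_mul_eq {U G : ℝ → ℂ} (hUG : IsWeakDeriv U G) (hU : MemLp U 2)
    (hG : MemLp G 2) {μ : ℝ} (hμ : 0 < μ) {ψ : ℝ → ℂ} (hψ : IsTest univ ψ) :
    ∫ x, U x * ψ x = ∫ x, (G x + μ * U x) *
      ((Real.exp (μ * x) : ℂ) * ∫ y in Ioi x, (Real.exp (-(μ * y)) : ℂ) * ψ y) := by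
  obtain ⟨B, hB⟩ := hψ.exists_bound
  set Ψ : ℝ → ℂ := fun y => (Real.exp (-(μ * y)) : ℂ) * ψ y with hΨ
  have hΨs : ContDiff ℝ ∞ Ψ := by
    refine ContDiff.mul ?_ hψ.smooth
    exact Complex.ofRealCLM.contDiff.comp (Real.contDiff_exp.comp (contDiff_const.mul contDiff_id).neg)
  have hΨi : Integrable Ψ :=
    hΨs.continuous.integrable_of_hasCompactSupport hψ.compact.mul_left
  set P : ℝ → ℂ := fun x => ∫ y in Ioi x, Ψ y with hP
  have hPeq : ∀ x, P x = (∫ y, Ψ y) - ((∫ y in Iic 0, Ψ y) + ∫ y in (0 : ℝ)..x, Ψ y) := by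
    intro x
    rw [← intervalIntegral.integral_Iic_sub_Iic hΨi.integrableOn hΨi.integrableOn,
      ← integral_add_compl (measurableSet_Iic (a := x)) hΨi, compl_Iic]
    simp only [hP]
    ring
  have hPd : ∀ x, HasDerivAt P (-Ψ x) x := by
    intro x
    have h1 : HasDerivAt (fun u => ∫ y in (0 : ℝ)..u, Ψ y) (Ψ x) x :=
      intervalIntegral.integral_hasDerivAt_right hΨi.intervalIntegrable
        (hΨs.continuous.stronglyMeasurableAtFilter _ _) hΨs.continuous.continuousAt
    have h2 := ((h1.const_add (∫ y in Iic 0, Ψ y)).const_sub (∫ y, Ψ y))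
    exact h2.congr_of_eventuallyEq (Eventually.of_forall hPeq)
  have hPs : ContDiff ℝ ∞ P := by
    rw [contDiff_infty_iff_deriv]
    refine ⟨fun x => (hPd x).differentiableAt, ?_⟩
    rw [show deriv P = fun x => -Ψ x from funext fun x => (hPd x).deriv]
    exact hΨs.neg
  have hP0 : ∀ x, B ≤ x → P x = 0 := by
    intro x hx
    refine setIntegral_eq_zero_of_forall_eq_zero fun y hy => ?_
    simp only [hΨ]
    rw [hB y (hx.trans (le_of_lt hy)), mul_zero]
  have hPb : ∀ x, ‖P x‖ ≤ ∫ y, ‖Ψ y‖ := fun x =>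
    (norm_integral_le_integral_norm _).trans
      (setIntegral_le_integral hΨi.norm (ae_of_all _ fun _ => norm_nonneg _))
  -- φ vanishes beyond B but in general only decays like exp(μx) at -∞, so it is not a test function
  -- and `IsWeakDeriv.integral_mul_deriv` is needed.
  set φ : ℝ → ℂ := fun x => (Real.exp (μ * x) : ℂ) * P x with hφ
  have hφs : ContDiff ℝ ∞ φ := by
    refine ContDiff.mul ?_ hPs
    exact Complex.ofRealCLM.contDiff.comp (Real.contDiff_exp.comp (contDiff_const.mul contDiff_id))
  have hφd : ∀ x, deriv φ x = μ * φ x - ψ x := by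
    intro x
    have h1 : HasDerivAt (fun x => (Real.exp (μ * x) : ℂ)) ((Real.exp (μ * x) * μ : ℝ) : ℂ) x := by
      have h0 : HasDerivAt (fun x => μ * x) μ x := by
        simpa using (hasDerivAt_id x).const_mul μ
      exact h0.exp.ofReal_comp
    have h3 : HasDerivAt φ _ x := h1.mul (hPd x)
    rw [h3.deriv]
    have h2 : (Real.exp (μ * x) : ℂ) * (Real.exp (-(μ * x)) : ℂ) = 1 := by
      rw [← Complex.ofReal_mul, ← Real.exp_add]
      simp
    simp only [hφ, hΨ, Complex.ofReal_mul]
    linear_combination (-ψ x) * h2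
  have hint : ∀ F : ℝ → ℂ, MemLp F 2 → Integrable fun x => F x * φ x := by
    intro F hF
    have h1 := (integrable_indicator_exp_mul hμ 0 B hF).norm.const_mul (∫ y, ‖Ψ y‖)
    refine h1.mono (hF.1.mul hφs.continuous.aestronglyMeasurable) (ae_of_all _ fun x => ?_)
    have hn : 0 ≤ ∫ y, ‖Ψ y‖ := integral_nonneg fun _ => norm_nonneg _
    by_cases hx : x ∈ Iic B
    · rw [indicator_of_mem hx]
      simp only [hφ, norm_mul, norm_norm, Real.norm_of_nonneg hn, sub_zero]
      nlinarith [mul_le_mul_of_nonneg_left (hPb x)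
        (mul_nonneg (norm_nonneg (F x)) (norm_nonneg (Real.exp (μ * x) : ℂ)))]
    · have : φ x = 0 := by
        simp only [hφ]
        rw [hP0 x (le_of_lt (not_le.1 hx)), mul_zero]
      rw [this, mul_zero, norm_zero]
      positivity
  have hψL : MemLp ψ 2 := hψ.smooth.continuous.memLp_of_hasCompactSupport hψ.compact
  have hUψ : Integrable fun x => U x * ψ x := hU.integrable_mul hψL
  have hUd : Integrable fun x => U x * deriv φ x := by
    simp only [hφd]
    refine (((hint U hU).const_mul (μ : ℂ)).sub hUψ).congr (ae_of_all _ fun x => ?_)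
    simp only [Pi.sub_apply]
    ring
  have key := hUG.integral_mul_deriv hφs (hint U hU) hUd (hint G hG)
  have e1 : ∫ x, U x * deriv φ x = (μ : ℂ) * (∫ x, U x * φ x) - ∫ x, U x * ψ x := by
    rw [← integral_const_mul, ← integral_sub ((hint U hU).const_mul _) hUψ]
    refine integral_congr_ae (ae_of_all _ fun x => ?_)
    simp only [hφd]
    ring
  have e2 : ∫ x, (G x + μ * U x) * φ x =
      (∫ x, G x * φ x) + (μ : ℂ) * ∫ x, U x * φ x := by
    rw [← integral_const_mul, ← integral_add (hint G hG) ((hint U hU).const_mul _)]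
    refine integral_congr_ae (ae_of_all _ fun x => ?_)
    simp only
    ring
  change _ = ∫ x, (G x + μ * U x) * φ x
  rw [e2]
  rw [e1] at key
  linear_combination -key

theorem integral_integral_expLeft {μ : ℝ} (hμ : 0 < μ) {h : ℝ → ℂ} (hh : MemLp h 2)
    {ψ : ℝ → ℂ} (hψ : IsTest univ ψ) :
    ∫ x, h x * ((Real.exp (μ * x) : ℂ) * ∫ y in Ioi x, (Real.exp (-(μ * y)) : ℂ) * ψ y) =
      ∫ y, (∫ x, expLeft μ y x * h x) * ψ y := by
  obtain ⟨B, hB⟩ := hψ.exists_bound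
  set Ψ : ℝ → ℂ := fun y => (Real.exp (-(μ * y)) : ℂ) * ψ y with hΨ
  have hΨi : Integrable Ψ := by
    refine Continuous.integrable_of_hasCompactSupport ?_ hψ.compact.mul_left
    exact Continuous.mul (by fun_prop) hψ.smooth.continuous
  -- Fubini needs integrability, which exp(μx) h(x) is guaranteed only on half-lines bounded above.
  -- Cutting at B changes nothing, as the inner integral is zero for x ≥ B.
  set H : ℝ → ℂ := (Iic B).indicator fun x => (Real.exp (μ * x) : ℂ) * h x with hH
  have hHi : Integrable H := by
    simpa only [sub_zero] using integrable_indicator_exp_mul hμ 0 B hh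
  have hF : Integrable (Function.uncurry fun x y : ℝ => (Ioi x).indicator (fun y => H x * Ψ y) y)
      (volume.prod volume) := by
    refine ((hHi.mul_prod hΨi).indicator (s := {p : ℝ × ℝ | p.1 < p.2})
      (measurableSet_lt measurable_fst measurable_snd)).congr (ae_of_all _ fun p => ?_)
    by_cases hp : p.1 < p.2
    · simp [Function.uncurry, hp]
    · simp [Function.uncurry, hp]
  have hswap := integral_integral_swap hF
  calc _ = ∫ x, ∫ y, (Ioi x).indicator (fun y => H x * Ψ y) y := by
        refine integral_congr_ae (ae_of_all _ fun x => ?_)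
        simp only
        rw [integral_indicator measurableSet_Ioi, integral_const_mul]
        by_cases hx : x ∈ Iic B
        · rw [hH, indicator_of_mem hx]
          ring
        · have : ∫ y in Ioi x, Ψ y = 0 := by
            refine setIntegral_eq_zero_of_forall_eq_zero fun y hy => ?_
            simp only [hΨ]
            rw [hB y ((not_le.1 hx).le.trans (le_of_lt hy)), mul_zero]
          rw [this]
          simp
    _ = _ := by
        rw [hswap]
        refine integral_congr_ae (ae_of_all _ fun y => ?_)
        simp only
        have e : (fun x => (Ioi x).indicator (fun y => H x * Ψ y) y) =
            (Iio y).indicator fun x => H x * Ψ y := by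
          ext x
          by_cases hx : x < y <;> simp [hx]
        rw [e, integral_indicator measurableSet_Iio, integral_mul_const, integral_expLeft_mul,
          ← integral_Iic_eq_integral_Iio]
        by_cases hy : B ≤ y
        · simp [hΨ, hB y hy]
        · have : ∫ x in Iic y, H x = ∫ x in Iic y, (Real.exp (μ * x) : ℂ) * h x := by
            refine setIntegral_congr_fun measurableSet_Iic fun x hx => ?_
            have hx' : x ∈ Iic B := le_trans (mem_Iic.1 hx) (not_le.1 hy).le
            rw [hH, indicator_of_mem hx']
          rw [this]
          simp only [hΨ]
          ring

/-- Both sides have the same integral against every smooth compactly supported function, by duality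
with φ' = μφ - ψ and Fubini. -/
theorem IsWeakDeriv.ae_eq {U G : ℝ → ℂ} (hUG : IsWeakDeriv U G) (hU : MemLp U 2)
    (hG : MemLp G 2) {μ : ℝ} (hμ : 0 < μ) :
    (fun y => ∫ x, expLeft μ y x * (G x + μ * U x)) =ᵐ[volume] U := by
  have hh : MemLp (fun x => G x + μ * U x) 2 := hG.add (hU.const_mul (μ : ℂ))
  have hc := continuous_integral_expLeft_mul hμ hh
  set v : ℝ → ℂ := fun y => ∫ x, expLeft μ y x * (G x + μ * U x) with hv
  have h0 := ae_eq_zero_of_integral_contDiff_smul_eq_zero (μ := volume) (f := v - U)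
    (hc.locallyIntegrable.sub (hU.locallyIntegrable (by norm_num))) ?_
  · filter_upwards [h0] with x hx
    exact sub_eq_zero.1 hx
  · intro g hg hgc
    have hψ : IsTest univ fun x => (g x : ℂ) :=
      ⟨Complex.ofRealCLM.contDiff.comp hg,
        hgc.comp_left (g := fun t : ℝ => (t : ℂ)) Complex.ofReal_zero, subset_univ _⟩
    have h1 := hUG.integral_mul_eq hU hG hμ hψ
    rw [integral_integral_expLeft hμ hh hψ] at h1
    have hψL : MemLp (fun x => (g x : ℂ)) 2 :=
      hψ.smooth.continuous.memLp_of_hasCompactSupport hψ.compact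
    have i1 : Integrable fun x => U x * (g x : ℂ) := hU.integrable_mul hψL
    have i2 : Integrable fun x => v x * (g x : ℂ) :=
      (hc.mul hψ.smooth.continuous).integrable_of_hasCompactSupport hψ.compact.mul_left
    have : ∫ x, g x • (v - U) x = (∫ x, v x * (g x : ℂ)) - ∫ x, U x * (g x : ℂ) := by
      rw [← integral_sub i2 i1]
      refine integral_congr_ae (ae_of_all _ fun x => ?_)
      simp only [Pi.sub_apply, Complex.real_smul]
      ring
    rw [this, h1, sub_self]

end WeakDerivative

/-! ### Point values controlled by the Green function -/

section PointValues

open Filter Set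

variable {ι : Type*} [Fintype ι]

theorem norm_sq_eq_integral {Ω : Set ℝ} (u : L2 Ω) : ‖u‖ ^ 2 = ∫ x in Ω, ‖u x‖ ^ 2 := by
  have h := inner_self_eq_norm_sq_to_K (𝕜 := ℂ) u
  rw [MeasureTheory.L2.inner_def] at h
  simp only [inner_self_eq_norm_sq_to_K] at h
  have h2 : ∫ x in Ω, ((‖u x‖ : ℂ)) ^ 2 = ((∫ x in Ω, ‖u x‖ ^ 2 : ℝ) : ℂ) := by
    rw [← integral_complex_ofReal]
    simp
  rw [show (∫ x in Ω, ((RCLike.ofReal ‖u x‖ : ℂ)) ^ 2) = _ from h2] at h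
  exact (Complex.ofReal_injective (by rw [h]; push_cast; rfl)).symm

theorem norm_toLp_sq {h : ℝ → ℂ} (hh : MemLp h 2) : ‖hh.toLp h‖ ^ 2 = ∫ x, ‖h x‖ ^ 2 := by
  have h1 := inner_self_eq_norm_sq_to_K (𝕜 := ℂ) (hh.toLp h)
  rw [MeasureTheory.L2.inner_def] at h1
  simp only [inner_self_eq_norm_sq_to_K] at h1
  have h2 : ∫ x, (RCLike.ofReal ‖hh.toLp h x‖ : ℂ) ^ 2 = ((∫ x, ‖h x‖ ^ 2 : ℝ) : ℂ) := by
    rw [← integral_complex_ofReal]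
    refine integral_congr_ae ?_
    filter_upwards [hh.coeFn_toLp] with x hx
    simp [hx]
  rw [h2] at h1
  exact (Complex.ofReal_injective (by rw [h1]; push_cast; rfl)).symm

theorem inner_toLp {a h : ℝ → ℂ} (ha : MemLp a 2) (hh : MemLp h 2) :
    inner ℂ (ha.toLp a) (hh.toLp h) = ∫ x, conj (a x) * h x := by
  rw [MeasureTheory.L2.inner_def]
  refine integral_congr_ae ?_
  filter_upwards [ha.coeFn_toLp, hh.coeFn_toLp] with x h1 h2
  rw [h1, h2, RCLike.inner_apply, mul_comm]

theorem conj_expLeft (μ y x : ℝ) : conj (expLeft μ y x) = expLeft μ y x := by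
  unfold expLeft
  by_cases hx : x ∈ Iic y
  · rw [indicator_of_mem hx, Complex.conj_ofReal]
  · rw [indicator_of_notMem hx, map_zero]

/-- The quadratic form of the Green function of `-d²/dx² + μ²` at the points `y`. -/
def greenForm (μ : ℝ) (y : ι → ℝ) (c : ι → ℂ) : ℝ :=
  ∑ m, ∑ n, Real.exp (-μ * |y m - y n|) / (2 * μ) * (c m * conj (c n)).re

/-- Cauchy–Schwarz for the pairing of h with a combination of truncated exponentials, whose squared
norm is a Gram form. -/
theorem norm_sum_expLeft_sq_le {μ : ℝ} (hμ : 0 < μ) (y : ι → ℝ) (c : ι → ℂ) {h : ℝ → ℂ}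
    (hh : MemLp h 2) :
    ‖∑ n, c n * ∫ x, expLeft μ (y n) x * h x‖ ^ 2 ≤ greenForm μ y c * ∫ x, ‖h x‖ ^ 2 := by
  let A : ι → Lp ℂ 2 (volume : Measure ℝ) := fun n => (memLp_expLeft hμ (y n)).toLp _
  have hA : ∀ m n, inner ℂ (A m) (A n) =
      ((Real.exp (-μ * |y m - y n|) / (2 * μ) : ℝ) : ℂ) := by
    intro m n
    simp only [A]
    rw [inner_toLp]
    simp only [conj_expLeft]
    exact integral_expLeft_mul_expLeft hμ _ _
  have h1 : ∑ n, c n * ∫ x, expLeft μ (y n) x * h x =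
      inner ℂ (∑ n, conj (c n) • A n) (hh.toLp h) := by
    rw [sum_inner]
    refine Finset.sum_congr rfl fun n _ => ?_
    rw [inner_smul_left, Complex.conj_conj]
    simp only [A]
    rw [inner_toLp]
    simp only [conj_expLeft]
  have h2 : ‖∑ n, conj (c n) • A n‖ ^ 2 = greenForm μ y c := by
    rw [← inner_self_eq_norm_sq (𝕜 := ℂ), sum_inner]
    simp only [inner_sum, inner_smul_left, inner_smul_right, hA, Complex.conj_conj, map_sum,
      greenForm]
    refine Finset.sum_congr rfl fun m _ => Finset.sum_congr rfl fun n _ => ?_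
    rw [← mul_assoc, mul_comm, RCLike.re_to_complex, Complex.re_ofReal_mul,
      mul_comm (conj (c n))]
  rw [h1, ← h2, ← norm_toLp_sq hh, ← mul_pow]
  exact pow_le_pow_left₀ (norm_nonneg _) (norm_inner_le_norm _ _) 2

theorem integrable_norm_sq {h : ℝ → ℂ} (hh : MemLp h 2) : Integrable fun x => ‖h x‖ ^ 2 :=
  (memLp_two_iff_integrable_sq_norm hh.1).1 hh

theorem MemLp.comp_neg_real {h : ℝ → ℂ} (hh : MemLp h 2) : MemLp (fun x => h (-x)) 2 :=
  hh.comp_measurePreserving (Measure.measurePreserving_neg volume)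

/-- Functions with an `L²` weak derivative on `ℝ` have a continuous representative `v`, whose
point values are controlled by the Green functions of `-d²/dx² + μ²`. -/
theorem IsWeakDeriv.exists_continuous {U G : ℝ → ℂ} (hUG : IsWeakDeriv U G) (hU : MemLp U 2)
    (hG : MemLp G 2) :
    ∃ v : ℝ → ℂ, Continuous v ∧ v =ᵐ[volume] U ∧
      ∀ (μ : ℝ) (N : ℕ) (y : Fin N → ℝ) (c : Fin N → ℂ), 0 < μ →
        ‖∑ n, c n * v (y n)‖ ^ 2 ≤
          greenForm μ y c * ((∫ x, ‖G x‖ ^ 2) + μ ^ 2 * ∫ x, ‖U x‖ ^ 2) := by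
  have hl : ∀ μ : ℝ, MemLp (fun x => G x + μ * U x) 2 := fun μ => hG.add (hU.const_mul (μ : ℂ))
  have hU' : MemLp (fun x => U (-x)) 2 := MemLp.comp_neg_real hU
  have hG' : MemLp (fun x => -G (-x)) 2 := (MemLp.comp_neg_real hG).neg
  have hr : ∀ μ : ℝ, MemLp (fun x => -G (-x) + μ * U (-x)) 2 := fun μ =>
    hG'.add (hU'.const_mul (μ : ℂ))
  -- The choice μ = 1 is arbitrary: the formulas for all μ > 0 give continuous functions equal to U
  -- almost everywhere, hence equal.
  set v : ℝ → ℂ := fun y => ∫ x, expLeft 1 y x * (G x + (1 : ℝ) * U x) with hv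
  have hvc : Continuous v := continuous_integral_expLeft_mul one_pos (hl 1)
  have hvU : v =ᵐ[volume] U := hUG.ae_eq hU hG one_pos
  refine ⟨v, hvc, hvU, fun μ N y c hμ => ?_⟩
  have hvl : ∀ y, v y = ∫ x, expLeft μ y x * (G x + μ * U x) := fun y => congrFun
    ((hvc.ae_eq_iff_eq volume (continuous_integral_expLeft_mul hμ (hl μ))).1
      (hvU.trans (hUG.ae_eq hU hG hμ).symm)) y
  have hvr : ∀ y, v y = ∫ x, expLeft μ (-y) x * (-G (-x) + μ * U (-x)) := by
    have h1 := hUG.comp_neg.ae_eq hU' hG' hμ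
    have h2 : (fun y => v (-y)) =ᵐ[volume] fun y => U (-y) :=
      (Measure.measurePreserving_neg volume).quasiMeasurePreserving.ae_eq hvU
    have h3 := ((hvc.comp continuous_neg).ae_eq_iff_eq volume
      (continuous_integral_expLeft_mul hμ (hr μ))).1 (h2.trans h1.symm)
    intro y
    simpa using congrFun h3 (-y)
  have b1 := norm_sum_expLeft_sq_le hμ y c (hl μ)
  have b2 := norm_sum_expLeft_sq_le hμ (fun n => -y n) c (hr μ)
  simp only [← hvl] at b1
  simp only [← hvr] at b2
  have hg : greenForm μ (fun n => -y n) c = greenForm μ y c := by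
    unfold greenForm
    refine Finset.sum_congr rfl fun m _ => Finset.sum_congr rfl fun n _ => ?_
    rw [neg_sub_neg, abs_sub_comm]
  rw [hg, ← integral_neg_eq_self] at b2
  simp only [neg_neg] at b2
  -- Averaging the bounds for u and for its reflection cancels the cross term between u' and u.
  have hpar : (∫ x, ‖G x + μ * U x‖ ^ 2) + ∫ x, ‖-G x + μ * U x‖ ^ 2 =
      2 * ((∫ x, ‖G x‖ ^ 2) + μ ^ 2 * ∫ x, ‖U x‖ ^ 2) := by
    have hr' : MemLp (fun x => -G x + μ * U x) 2 := hG.neg.add (hU.const_mul (μ : ℂ))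
    rw [← integral_add (integrable_norm_sq (hl μ)) (integrable_norm_sq hr'), ← integral_const_mul,
      ← integral_add (integrable_norm_sq hG) ((integrable_norm_sq hU).const_mul _),
      ← integral_const_mul]
    refine integral_congr_ae (ae_of_all _ fun x => ?_)
    simp only
    have := parallelogram_law_with_norm ℂ (μ * U x) (G x)
    rw [norm_mul, Complex.norm_real, mul_pow, Real.norm_eq_abs, sq_abs] at this
    rw [add_comm (G x), neg_add_eq_sub, this]
    ring
  have hb := add_le_add b1 b2
  rw [← mul_add, hpar] at hb
  linarith

/-- An element `(u, u')` of `L²(Ω) × L²(Ω)` with a continuous `u`, such that the point values of `u`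
are controlled by the Green functions of `-d²/dx² + μ²` on `ℝ`. -/
def IsRegular {Ω : Set ℝ} (p : L2 Ω × L2 Ω) : Prop :=
  ∃ v : ℝ → ℂ, Continuous v ∧ v =ᵐ[volume.restrict Ω] p.1 ∧
    ∀ (μ : ℝ) (N : ℕ) (y : Fin N → ℝ) (c : Fin N → ℂ), 0 < μ → (∀ n, y n ∈ Ω) →
      ‖∑ n, c n * v (y n)‖ ^ 2 ≤ greenForm μ y c * (‖p.2‖ ^ 2 + μ ^ 2 * ‖p.1‖ ^ 2)

theorem integral_indicator_mul {Ω : Set ℝ} (hΩ : MeasurableSet Ω) (f g : ℝ → ℂ) :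
    ∫ x, Ω.indicator f x * g x = ∫ x in Ω, f x * g x := by
  rw [← integral_indicator hΩ]
  simp only [indicator_mul_left]

/-- The test functions need not be supported in Ω, so the hypothesis says that the extension by zero
is weakly differentiable on ℝ. -/
theorem isRegular_of_isWeakDeriv {Ω : Set ℝ} (hΩ : MeasurableSet Ω) {p : L2 Ω × L2 Ω}
    (hp : ∀ φ : ℝ → ℂ, IsTest univ φ →
      ∫ x in Ω, p.1 x * deriv φ x = -∫ x in Ω, p.2 x * φ x) : IsRegular p := by
  have hU : MemLp (Ω.indicator p.1) 2 := (memLp_indicator_iff_restrict hΩ).2 (Lp.memLp p.1)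
  have hG : MemLp (Ω.indicator p.2) 2 := (memLp_indicator_iff_restrict hΩ).2 (Lp.memLp p.2)
  have hUG : IsWeakDeriv (Ω.indicator p.1) (Ω.indicator p.2) := by
    intro φ hφ
    rw [integral_indicator_mul hΩ, integral_indicator_mul hΩ]
    exact hp φ hφ
  have hn : ∀ u : L2 Ω, ∫ x, ‖Ω.indicator u x‖ ^ 2 = ‖u‖ ^ 2 := by
    intro u
    rw [norm_sq_eq_integral, ← integral_indicator hΩ]
    refine integral_congr_ae (ae_of_all _ fun x => ?_)
    by_cases hx : x ∈ Ω <;> simp [hx]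
  obtain ⟨v, hvc, hvU, hb⟩ := hUG.exists_continuous hU hG
  refine ⟨v, hvc, ?_, fun μ N y c hμ _ => ?_⟩
  · filter_upwards [ae_restrict_of_ae hvU, ae_restrict_mem hΩ] with x h1 hx
    rw [h1, indicator_of_mem hx]
  · have := hb μ N y c hμ
    rwa [hn, hn] at this

theorem isRegular_of_mem_sobolevW {p : L2 univ × L2 univ} (hp : p ∈ sobolevW univ) :
    IsRegular p :=
  isRegular_of_isWeakDeriv MeasurableSet.univ hp

theorem continuous_integral_mul {Ω : Set ℝ} {ψ : ℝ → ℂ} (hψ : MemLp ψ 2 (volume.restrict Ω)) :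
    Continuous fun u : L2 Ω => ∫ x in Ω, u x * ψ x := by
  have h : (fun u : L2 Ω => ∫ x in Ω, u x * ψ x) =
      fun u => inner ℂ (hψ.star.toLp (star ψ)) u := by
    ext u
    rw [MeasureTheory.L2.inner_def]
    refine integral_congr_ae ?_
    filter_upwards [hψ.star.coeFn_toLp] with x hx
    rw [hx, RCLike.inner_apply]
    simp
  rw [h]
  exact continuous_const.inner continuous_id

theorem IsTest.mono {Ω Ω' : Set ℝ} (h : Ω ⊆ Ω') {φ : ℝ → ℂ} (hφ : IsTest Ω φ) : IsTest Ω' φ :=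
  ⟨hφ.smooth, hφ.compact, hφ.subset.trans h⟩

theorem integral_mul_deriv_of_isTest {φ ψ : ℝ → ℂ} (hφ : IsTest univ φ) (hψ : IsTest univ ψ) :
    ∫ x, φ x * deriv ψ x = -∫ x, deriv φ x * ψ x := by
  have c1 := hφ.smooth.continuous_deriv (by simp)
  have c2 := hψ.smooth.continuous_deriv (by simp)
  refine integral_mul_deriv_eq_deriv_mul_of_integrable
    (fun x _ => (hφ.smooth.differentiable (by simp) x).hasDerivAt)
    (fun x _ => (hψ.smooth.differentiable (by simp) x).hasDerivAt) ?_ ?_ ?_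
  · exact (hφ.smooth.continuous.mul c2).integrable_of_hasCompactSupport hφ.compact.mul_right
  · exact (c1.mul hψ.smooth.continuous).integrable_of_hasCompactSupport hψ.compact.mul_left
  · exact (hφ.smooth.continuous.mul hψ.smooth.continuous).integrable_of_hasCompactSupport
      hφ.compact.mul_right

/-- The Dirichlet condition enters here: for test pairs integration by parts has no boundary term,
and the resulting identity is closed in L² × L². -/
theorem isRegular_of_mem_sobolevW0 {Ω : Set ℝ} (hΩ : MeasurableSet Ω) {p : L2 Ω × L2 Ω}
    (hp : p ∈ sobolevW0 Ω) : IsRegular p := by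
  refine isRegular_of_isWeakDeriv hΩ fun φ hφ => ?_
  have hφ1 : MemLp φ 2 (volume.restrict Ω) :=
    (hφ.smooth.continuous.memLp_of_hasCompactSupport hφ.compact).restrict Ω
  have hφ2 : MemLp (deriv φ) 2 (volume.restrict Ω) :=
    ((hφ.smooth.continuous_deriv (by simp)).memLp_of_hasCompactSupport hφ.compact.deriv).restrict Ω
  have hcl : IsClosed {q : L2 Ω × L2 Ω |
      ∫ x in Ω, q.1 x * deriv φ x = -∫ x in Ω, q.2 x * φ x} :=
    isClosed_eq ((continuous_integral_mul hφ2).comp continuous_fst)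
      ((continuous_integral_mul hφ1).comp continuous_snd).neg
  have hsub : (testPairs Ω : Set (L2 Ω × L2 Ω)) ⊆ {q : L2 Ω × L2 Ω |
      ∫ x in Ω, q.1 x * deriv φ x = -∫ x in Ω, q.2 x * φ x} := by
    rintro q ⟨χ, hχ, h1, h2⟩
    have e1 : ∫ x in Ω, q.1 x * deriv φ x = ∫ x, χ x * deriv φ x := by
      rw [← setIntegral_eq_integral_of_forall_compl_eq_zero (s := Ω) (f := fun x => χ x * deriv φ x)]
      · refine integral_congr_ae ?_
        filter_upwards [h1] with x hx
        rw [hx]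
      · intro x hx
        rw [image_eq_zero_of_notMem_tsupport fun h => hx (hχ.subset h), zero_mul]
    have e2 : ∫ x in Ω, q.2 x * φ x = ∫ x, deriv χ x * φ x := by
      rw [← setIntegral_eq_integral_of_forall_compl_eq_zero (s := Ω) (f := fun x => deriv χ x * φ x)]
      · refine integral_congr_ae ?_
        filter_upwards [h2] with x hx
        rw [hx]
      · intro x hx
        rw [image_eq_zero_of_notMem_tsupport (f := deriv χ)
          fun h => hx (hχ.subset (tsupport_deriv_subset (𝕜 := ℝ) h)), zero_mul]
    simp only [mem_ofPred_eq]
    rw [e1, e2]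
    exact integral_mul_deriv_of_isTest (hχ.mono (subset_univ Ω)) hφ
  have : p ∈ closure (testPairs Ω : Set (L2 Ω × L2 Ω)) := by
    rwa [← Submodule.topologicalClosure_coe]
  exact closure_minimal hsub hcl this

end PointValues

/-! ### The form, its eigenspaces and the energy inequality -/

section FormOperator

open Filter Set

variable {Ω : Set ℝ}

theorem IsRegular.exists_continuousOn {p : L2 Ω × L2 Ω} (hp : IsRegular p) :
    ∃ v : ℝ → ℂ, ContinuousOn v Ω ∧ v =ᵐ[volume.restrict Ω] p.1 :=
  let ⟨v, hvc, hv, _⟩ := hp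
  ⟨v, hvc.continuousOn, hv⟩

theorem IsRegular.continuousOn_contRep {p : L2 Ω × L2 Ω} (hp : IsRegular p) :
    ContinuousOn (contRep Ω p.1) Ω := by
  rw [contRep, dif_pos hp.exists_continuousOn]
  exact hp.exists_continuousOn.choose_spec.1

theorem IsRegular.contRep_ae_eq {p : L2 Ω × L2 Ω} (hp : IsRegular p) :
    contRep Ω p.1 =ᵐ[volume.restrict Ω] p.1 := by
  have h := hp.exists_continuousOn.choose_spec.2
  rwa [contRep, dif_pos hp.exists_continuousOn]

/-- Uniqueness on open Ω is what makes `contRep`, defined by choice, linear in p there. -/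
theorem IsRegular.contRep_eqOn (hΩ : IsOpen Ω) {p : L2 Ω × L2 Ω} (hp : IsRegular p) {v : ℝ → ℂ}
    (hvc : ContinuousOn v Ω) (hv : v =ᵐ[volume.restrict Ω] p.1) : EqOn (contRep Ω p.1) v Ω :=
  Measure.eqOn_open_of_ae_eq (hp.contRep_ae_eq.trans hv.symm) hΩ hp.continuousOn_contRep hvc

theorem IsRegular.contRep_add (hΩ : IsOpen Ω) {p q : L2 Ω × L2 Ω} (hp : IsRegular p)
    (hq : IsRegular q) (hpq : IsRegular (p + q)) {x : ℝ} (hx : x ∈ Ω) :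
    contRep Ω (p + q).1 x = contRep Ω p.1 x + contRep Ω q.1 x := by
  refine hpq.contRep_eqOn hΩ (v := fun x => contRep Ω p.1 x + contRep Ω q.1 x)
    (hp.continuousOn_contRep.add hq.continuousOn_contRep) ?_ hx
  exact (hp.contRep_ae_eq.add hq.contRep_ae_eq).trans (Lp.coeFn_add _ _).symm

theorem IsRegular.contRep_smul (hΩ : IsOpen Ω) (c : ℂ) {p : L2 Ω × L2 Ω} (hp : IsRegular p)
    (hcp : IsRegular (c • p)) {x : ℝ} (hx : x ∈ Ω) :
    contRep Ω (c • p).1 x = c * contRep Ω p.1 x := by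
  refine hcp.contRep_eqOn hΩ (v := fun x => c * contRep Ω p.1 x)
    (continuousOn_const.mul hp.continuousOn_contRep) ?_ hx
  exact (hp.contRep_ae_eq.const_smul c).trans (Lp.coeFn_smul _ _).symm

theorem IsRegular.norm_sum_contRep_sq_le (hΩ : IsOpen Ω) {p : L2 Ω × L2 Ω} (hp : IsRegular p)
    {μ : ℝ} (hμ : 0 < μ) {N : ℕ} {y : Fin N → ℝ} (hy : ∀ n, y n ∈ Ω) (c : Fin N → ℂ) :
    ‖∑ n, c n * contRep Ω p.1 (y n)‖ ^ 2 ≤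
      greenForm μ y c * (‖p.2‖ ^ 2 + μ ^ 2 * ‖p.1‖ ^ 2) := by
  obtain ⟨v, hvc, hv, hb⟩ := id hp
  have := hp.contRep_eqOn hΩ hvc.continuousOn hv
  simp only [fun n => this (hy n)]
  exact hb μ N y c hμ hy

theorem IsRegular.norm_contRep_sq_le (hΩ : IsOpen Ω) {p : L2 Ω × L2 Ω} (hp : IsRegular p)
    {μ : ℝ} (hμ : 0 < μ) {x : ℝ} (hx : x ∈ Ω) :
    ‖contRep Ω p.1 x‖ ^ 2 ≤ 1 / (2 * μ) * (‖p.2‖ ^ 2 + μ ^ 2 * ‖p.1‖ ^ 2) := by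
  have := hp.norm_sum_contRep_sq_le hΩ hμ (N := 1) (y := fun _ => x) (fun _ => hx) (fun _ => 1)
  simpa [greenForm] using this

variable {V : ℕ+ → ℝ} {Q : Submodule ℂ (L2 Ω × L2 Ω)}

theorem summable_form (hV : Summable fun n => |V n|) (hΩ : IsOpen Ω)
    (hpts : ∀ n : ℕ+, ((n : ℕ) : ℝ) ∈ Ω) {p q : L2 Ω × L2 Ω} (hp : IsRegular p)
    (hq : IsRegular q) :
    Summable fun n : ℕ+ =>
      (V n : ℂ) * (conj (contRep Ω p.1 (n : ℕ)) * contRep Ω q.1 (n : ℕ)) := by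
  refine Summable.of_norm_bounded (hV.mul_right
    ((1 / (2 * 1) * (‖p.2‖ ^ 2 + 1 ^ 2 * ‖p.1‖ ^ 2)) +
      1 / (2 * 1) * (‖q.2‖ ^ 2 + 1 ^ 2 * ‖q.1‖ ^ 2))) fun n => ?_
  rw [norm_mul, norm_mul, Complex.norm_real, RCLike.norm_conj, Real.norm_eq_abs]
  gcongr
  have h1 := hp.norm_contRep_sq_le hΩ one_pos (hpts n)
  have h2 := hq.norm_contRep_sq_le hΩ one_pos (hpts n)
  nlinarith [sq_nonneg (‖contRep Ω p.1 (n : ℕ)‖ - ‖contRep Ω q.1 (n : ℕ)‖)]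

theorem form_add_right (hV : Summable fun n => |V n|) (hΩ : IsOpen Ω)
    (hpts : ∀ n : ℕ+, ((n : ℕ) : ℝ) ∈ Ω) (hQ : ∀ p ∈ Q, IsRegular p) {p q r : L2 Ω × L2 Ω}
    (hp : p ∈ Q) (hq : q ∈ Q) (hr : r ∈ Q) :
    form Ω V p (q + r) = form Ω V p q + form Ω V p r := by
  unfold form
  rw [Prod.snd_add, inner_add_right, add_add_add_comm,
    ← (summable_form hV hΩ hpts (hQ p hp) (hQ q hq)).tsum_add
      (summable_form hV hΩ hpts (hQ p hp) (hQ r hr))]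
  congr 1
  refine tsum_congr fun n => ?_
  rw [(hQ q hq).contRep_add hΩ (hQ r hr) (hQ _ (Q.add_mem hq hr)) (hpts n)]
  ring

theorem form_smul_right (hΩ : IsOpen Ω) (hpts : ∀ n : ℕ+, ((n : ℕ) : ℝ) ∈ Ω)
    (hQ : ∀ p ∈ Q, IsRegular p) (c : ℂ) (p : L2 Ω × L2 Ω) {q : L2 Ω × L2 Ω} (hq : q ∈ Q) :
    form Ω V p (c • q) = c * form Ω V p q := by
  unfold form
  rw [Prod.smul_snd, inner_smul_right, mul_add, ← tsum_mul_left]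
  congr 1
  refine tsum_congr fun n => ?_
  rw [(hQ q hq).contRep_smul hΩ c (hQ _ (Q.smul_mem c hq)) (hpts n)]
  ring

theorem conj_form (p q : L2 Ω × L2 Ω) : conj (form Ω V p q) = form Ω V q p := by
  unfold form
  rw [map_add, inner_conj_symm, Complex.conj_tsum]
  congr 1
  refine tsum_congr fun n => ?_
  simp only [map_mul, Complex.conj_ofReal, Complex.conj_conj]
  ring

theorem form_sum_right (hV : Summable fun n => |V n|) (hΩ : IsOpen Ω)
    (hpts : ∀ n : ℕ+, ((n : ℕ) : ℝ) ∈ Ω) (hQ : ∀ p ∈ Q, IsRegular p) {ι : Type*}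
    {p : L2 Ω × L2 Ω} (hp : p ∈ Q) {q : ι → L2 Ω × L2 Ω} (hq : ∀ i, q i ∈ Q) (a : ι → ℂ)
    (s : Finset ι) :
    form Ω V p (∑ i ∈ s, a i • q i) = ∑ i ∈ s, a i * form Ω V p (q i) := by
  classical
  induction s using Finset.induction_on with
  | empty =>
    have := form_smul_right (V := V) hΩ hpts hQ 0 p hp
    simpa using this
  | insert i s hi ih =>
    rw [Finset.sum_insert hi, Finset.sum_insert hi, form_add_right hV hΩ hpts hQ hp
      (Q.smul_mem _ (hq i)) (Q.sum_mem fun j _ => Q.smul_mem _ (hq j)),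
      form_smul_right hΩ hpts hQ _ _ (hq i), ih]

theorem form_self_re (hV : Summable fun n => |V n|) (hΩ : IsOpen Ω)
    (hpts : ∀ n : ℕ+, ((n : ℕ) : ℝ) ∈ Ω) {p : L2 Ω × L2 Ω} (hp : IsRegular p) :
    (form Ω V p p).re = ‖p.2‖ ^ 2 + ∑' n : ℕ+, V n * ‖contRep Ω p.1 (n : ℕ)‖ ^ 2 := by
  unfold form
  rw [Complex.add_re, Complex.re_tsum (summable_form hV hΩ hpts hp hp)]
  congr 1
  · rw [inner_self_eq_norm_sq_to_K]
    norm_cast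
  · refine tsum_congr fun n => ?_
    rw [Complex.conj_mul', Complex.re_ofReal_mul]
    norm_cast

/-- The eigenspace of the operator of the form. -/
def eigenspace (hV : Summable fun n => |V n|) (hΩ : IsOpen Ω)
    (hpts : ∀ n : ℕ+, ((n : ℕ) : ℝ) ∈ Ω) (hQ : ∀ p ∈ Q, IsRegular p) (E : ℝ) :
    Submodule ℂ (L2 Ω) where
  carrier := {u | (u, (E : ℂ) • u) ∈ formOperator Ω Q V}
  zero_mem' := by
    refine ⟨0, Q.zero_mem, fun p hp => ?_⟩
    have := form_smul_right (V := V) hΩ hpts hQ 0 p hp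
    rw [zero_smul, zero_mul] at this
    simp only [smul_zero, inner_zero_right]
    exact this
  add_mem' := by
    rintro u v ⟨g, hg, hug⟩ ⟨h, hh, hvh⟩
    refine ⟨g + h, Q.add_mem hg hh, fun p hp => ?_⟩
    have := form_add_right hV hΩ hpts hQ hp hg hh
    rw [hug p hp, hvh p hp, ← inner_add_right, ← smul_add] at this
    exact this
  smul_mem' := by
    rintro c u ⟨g, hg, hug⟩
    refine ⟨c • g, Q.smul_mem c hg, fun p hp => ?_⟩
    have := form_smul_right (V := V) hΩ hpts hQ c p hg
    rw [hug p hp, ← inner_smul_right, smul_comm] at this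
    exact this

theorem inner_eq_zero_of_ne {E F : ℝ} (hEF : E ≠ F) {u v : L2 Ω}
    (hu : (u, (E : ℂ) • u) ∈ formOperator Ω Q V) (hv : (v, (F : ℂ) • v) ∈ formOperator Ω Q V) :
    inner ℂ u v = 0 := by
  obtain ⟨g, hg, hug⟩ := hu
  obtain ⟨h, hh, hvh⟩ := hv
  have h1 := hug _ hh
  have h2 := hvh _ hg
  simp only [inner_smul_right] at h1 h2
  rw [← conj_form, h2, map_mul, inner_conj_symm, Complex.conj_ofReal] at h1
  have h3 : ((F : ℂ) - E) * inner ℂ v u = 0 := by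
    rw [sub_mul, h1, sub_self]
  rcases mul_eq_zero.1 h3 with h4 | h4
  · exact absurd (Complex.ofReal_injective (sub_eq_zero.1 h4)).symm hEF
  · exact inner_eq_zero_symm.1 h4

/-- On the span of eigenfunctions with eigenvalue at most `-μ²`, the energy is bounded by the
potential. -/
theorem energy_le (hV : Summable fun n => |V n|) (hΩ : IsOpen Ω)
    (hpts : ∀ n : ℕ+, ((n : ℕ) : ℝ) ∈ Ω) (hQ : ∀ p ∈ Q, IsRegular p) {ι : Type*} [Fintype ι]
    {κ : ι → ℝ} {p : ι → L2 Ω × L2 Ω} (hpQ : ∀ i, p i ∈ Q)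
    (hp : ∀ i, ∀ q ∈ Q, form Ω V q (p i) = inner ℂ q.1 (((-κ i ^ 2 : ℝ) : ℂ) • (p i).1))
    (ho : Orthonormal ℂ fun i => (p i).1) {μ : ℝ} (hμ : 0 ≤ μ) (a : ι → ℂ)
    (ha : ∀ i, a i ≠ 0 → μ ≤ κ i) :
    ‖(∑ i, a i • p i).2‖ ^ 2 + μ ^ 2 * ‖(∑ i, a i • p i).1‖ ^ 2 ≤
      ∑' n : ℕ+, |V n| * ‖contRep Ω (∑ i, a i • p i).1 (n : ℕ)‖ ^ 2 := by
  have hPQ : ∑ i, a i • p i ∈ Q := Q.sum_mem fun i _ => Q.smul_mem _ (hpQ i)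
  set P := ∑ i, a i • p i with hP
  have hP1 : P.1 = ∑ i, a i • (p i).1 := by
    rw [hP, Prod.fst_sum]
    rfl
  have hn : ‖P.1‖ ^ 2 = ∑ i, ‖a i‖ ^ 2 := by
    have h := ho.inner_sum a a Finset.univ
    rw [← hP1, inner_self_eq_norm_sq_to_K] at h
    simp only [Complex.conj_mul'] at h
    exact Complex.ofReal_injective (by push_cast; exact h)
  -- The eigenvalue equations reduce the form to L² inner products, so orthonormality makes it
  -- diagonal.
  have hform : form Ω V P P = ((∑ i, -κ i ^ 2 * ‖a i‖ ^ 2 : ℝ) : ℂ) := by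
    have h := form_sum_right hV hΩ hpts hQ hPQ hpQ a Finset.univ
    rw [← hP] at h
    rw [h]
    push_cast
    refine Finset.sum_congr rfl fun i _ => ?_
    rw [hp i P hPQ, inner_smul_right, hP1, ho.inner_left_fintype, ← Complex.mul_conj']
    push_cast
    ring
  have hre := form_self_re hV hΩ hpts (hQ P hPQ)
  rw [hform, Complex.ofReal_re] at hre
  have hs : Summable fun n : ℕ+ => |V n| * ‖contRep Ω P.1 (n : ℕ)‖ ^ 2 := by
    refine Summable.of_nonneg_of_le (fun n => by positivity) (fun n => ?_)
      (hV.mul_right (1 / (2 * 1) * (‖P.2‖ ^ 2 + 1 ^ 2 * ‖P.1‖ ^ 2)))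
    gcongr
    exact (hQ P hPQ).norm_contRep_sq_le hΩ one_pos (hpts n)
  have hle : -∑' n : ℕ+, V n * ‖contRep Ω P.1 (n : ℕ)‖ ^ 2 ≤
      ∑' n : ℕ+, |V n| * ‖contRep Ω P.1 (n : ℕ)‖ ^ 2 := by
    have hs' : Summable fun n : ℕ+ => V n * ‖contRep Ω P.1 (n : ℕ)‖ ^ 2 :=
      Summable.of_norm_bounded hs fun n => by
        rw [norm_mul, Real.norm_eq_abs, Real.norm_of_nonneg (by positivity)]
    rw [← tsum_neg]
    refine hs'.neg.tsum_le_tsum (fun n => ?_) hs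
    rw [← neg_mul]
    gcongr
    exact neg_le_abs _
  have hsum : μ ^ 2 * ∑ i, ‖a i‖ ^ 2 ≤ ∑ i, κ i ^ 2 * ‖a i‖ ^ 2 := by
    rw [Finset.mul_sum]
    refine Finset.sum_le_sum fun i _ => ?_
    by_cases hi : a i = 0
    · simp [hi]
    · gcongr
      exact ha i hi
  simp only [neg_mul, Finset.sum_neg_distrib] at hre
  rw [hn]
  linarith

end FormOperator

/-! ### The Birman–Schwinger bound and summation over eigenvalues -/

section EigenvalueBound

open Filter Set

variable {Ω : Set ℝ} {V : ℕ+ → ℝ} {Q : Submodule ℂ (L2 Ω × L2 Ω)}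

/-- Evaluation of the elements of the form domain at `1, …, N`, weighted by `w`. -/
def evalMap (hΩ : IsOpen Ω) (hpts : ∀ n : ℕ+, ((n : ℕ) : ℝ) ∈ Ω) (hQ : ∀ p ∈ Q, IsRegular p)
    {N : ℕ} (w : Fin N → ℝ) : Q →ₗ[ℂ] EuclideanSpace ℂ (Fin N) where
  toFun p := WithLp.toLp 2 fun n => (w n : ℂ) * contRep Ω p.1.1 ((n : ℕ).succPNat : ℕ)
  map_add' p q := by
    ext n
    have := (hQ _ p.2).contRep_add hΩ (hQ _ q.2) (hQ _ (p + q).2) (hpts (n : ℕ).succPNat)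
    simp only [PiLp.add_apply]
    rw [← mul_add, ← this]
    rfl
  map_smul' c p := by
    ext n
    have := (hQ _ p.2).contRep_smul hΩ c (hQ _ (c • p).2) (hpts (n : ℕ).succPNat)
    simp only [PiLp.smul_apply, smul_eq_mul, RingHom.id_apply]
    rw [mul_left_comm, ← this]
    rfl

theorem abs_cast_sub_eq_dist (m n : ℕ) :
    |((m.succPNat : ℕ) : ℝ) - ((n.succPNat : ℕ) : ℝ)| = Nat.dist m n := by
  simp only [Nat.succPNat_coe, Nat.succ_eq_add_one, Nat.cast_add, Nat.cast_one,
    add_sub_add_right_eq_sub]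
  rcases le_total m n with h | h
  · rw [Nat.dist_eq_sub_of_le h, Nat.cast_sub h, abs_sub_comm, abs_of_nonneg]
    exact sub_nonneg.2 (Nat.cast_le.2 h)
  · rw [Nat.dist_eq_sub_of_le_right h, Nat.cast_sub h, abs_of_nonneg]
    exact sub_nonneg.2 (Nat.cast_le.2 h)

theorem greenForm_eq_kernelForm (μ : ℝ) {N : ℕ} (w : Fin N → ℝ)
    (c : EuclideanSpace ℂ (Fin N)) :
    greenForm μ (fun n : Fin N => (((n : ℕ).succPNat : ℕ) : ℝ)) (fun n => (w n : ℂ) * conj (c n)) =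
      kernelForm w (Real.exp (-μ)) c / (2 * μ) := by
  unfold greenForm kernelForm
  rw [Finset.sum_div]
  refine Finset.sum_congr rfl fun m _ => ?_
  rw [Finset.sum_div]
  refine Finset.sum_congr rfl fun n _ => ?_
  have h : (w m : ℂ) * conj (c m) * conj ((w n : ℂ) * conj (c n)) =
      ((w m * w n : ℝ) : ℂ) * (conj (c m) * c n) := by
    simp
    ring
  rw [h, Complex.re_ofReal_mul, abs_cast_sub_eq_dist, ← Real.exp_nat_mul]
  rw [mul_comm (-μ)]
  ring

/-- If the energy of `p` is at most the potential energy, and the potential beyond the first `N`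
points has size less than `2 μ`, then the Birman-Schwinger form is large on the values of `p` at the
first `N` points. -/
theorem evalMap_ne_zero_and_le (hΩ : IsOpen Ω) (hpts : ∀ n : ℕ+, ((n : ℕ) : ℝ) ∈ Ω)
    (hQ : ∀ p ∈ Q, IsRegular p) (hV : Summable fun n : ℕ => |V n.succPNat|) (N : ℕ) {μ : ℝ}
    (hμ : 0 < μ) (hN : ∑' k : ℕ, |V (k + N).succPNat| < 2 * μ) (p : Q) (hp0 : p.1.1 ≠ 0)
    (hp : ‖p.1.2‖ ^ 2 + μ ^ 2 * ‖p.1.1‖ ^ 2 ≤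
      ∑' n : ℕ, |V n.succPNat| * ‖contRep Ω p.1.1 (n.succPNat : ℕ)‖ ^ 2) :
    evalMap hΩ hpts hQ (fun n : Fin N => √|V (n : ℕ).succPNat|) p ≠ 0 ∧
      (2 * μ - ∑' k : ℕ, |V (k + N).succPNat|) *
          ‖evalMap hΩ hpts hQ (fun n : Fin N => √|V (n : ℕ).succPNat|) p‖ ^ 2 ≤
        kernelForm (fun n : Fin N => √|V (n : ℕ).succPNat|) (Real.exp (-μ))
          (evalMap hΩ hpts hQ (fun n : Fin N => √|V (n : ℕ).succPNat|) p) := by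
  set w : Fin N → ℝ := fun n => √|V (n : ℕ).succPNat| with hw
  set T := evalMap hΩ hpts hQ w p with hT
  set q := ‖p.1.2‖ ^ 2 + μ ^ 2 * ‖p.1.1‖ ^ 2 with hq
  set δ := ∑' k : ℕ, |V (k + N).succPNat| with hδ
  set e : ℕ → ℂ := fun n => contRep Ω p.1.1 (n.succPNat : ℕ) with he
  have hq0 : 0 < q := by
    have : 0 < ‖p.1.1‖ := norm_pos_iff.2 hp0
    positivity
  have hTn : ∀ n, T n = (w n : ℂ) * e n := fun n => rfl
  have hww : ∀ n, w n ^ 2 = |V (n : ℕ).succPNat| := fun n => Real.sq_sqrt (abs_nonneg _)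
  have hS : ‖T‖ ^ 2 = ∑ n ∈ Finset.range N, |V n.succPNat| * ‖e n‖ ^ 2 := by
    rw [EuclideanSpace.norm_sq_eq, ← Fin.sum_univ_eq_sum_range
      fun n => |V n.succPNat| * ‖e n‖ ^ 2]
    refine Finset.sum_congr rfl fun n _ => ?_
    rw [hTn, norm_mul, mul_pow, Complex.norm_real, Real.norm_eq_abs, sq_abs, hww]
  have hpt : ∀ n, ‖e n‖ ^ 2 ≤ 1 / (2 * μ) * q := fun n =>
    (hQ _ p.2).norm_contRep_sq_le hΩ hμ (hpts _)
  have hsum : Summable fun n : ℕ => |V n.succPNat| * ‖e n‖ ^ 2 := by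
    refine Summable.of_nonneg_of_le (fun n => by positivity) (fun n => ?_)
      (hV.mul_right (1 / (2 * μ) * q))
    gcongr
    exact hpt n
  have htail : ∑' k : ℕ, |V (k + N).succPNat| * ‖e (k + N)‖ ^ 2 ≤ δ * (1 / (2 * μ) * q) := by
    rw [hδ, ← tsum_mul_right]
    refine Summable.tsum_le_tsum (fun n => ?_) ((summable_nat_add_iff N).2 hsum)
      (((summable_nat_add_iff N).2 hV).mul_right _)
    gcongr
    exact hpt _
  have hqS : q ≤ ‖T‖ ^ 2 + δ * (1 / (2 * μ) * q) := by
    refine hp.trans ?_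
    rw [← hsum.sum_add_tsum_nat_add N, hS]
    gcongr
  have hqS' : (2 * μ - δ) * q ≤ 2 * μ * ‖T‖ ^ 2 := by
    have h : 2 * μ * (δ * (1 / (2 * μ) * q)) = δ * q := by
      field_simp
    nlinarith [mul_le_mul_of_nonneg_left hqS (by positivity : (0 : ℝ) ≤ 2 * μ)]
  have hSpos : 0 < ‖T‖ ^ 2 := by
    have : 0 < (2 * μ - δ) * q := mul_pos (by linarith) hq0
    by_contra hcon
    nlinarith [mul_nonneg hμ.le (sub_nonneg.2 (not_lt.1 hcon))]
  -- With these coefficients the sum of point values is ‖T‖², so the Green bound reads 2μ‖T‖⁴ ≤ K q.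
  have hbs := (hQ _ p.2).norm_sum_contRep_sq_le hΩ hμ
    (y := fun n : Fin N => (((n : ℕ).succPNat : ℕ) : ℝ)) (fun n => hpts _)
    (fun n => (w n : ℂ) * conj (T n))
  have hsumS : ∑ n : Fin N, (w n : ℂ) * conj (T n) * contRep Ω p.1.1 (((n : ℕ).succPNat : ℕ) : ℝ) =
      ((‖T‖ ^ 2 : ℝ) : ℂ) := by
    rw [EuclideanSpace.norm_sq_eq]
    push_cast
    refine Finset.sum_congr rfl fun n _ => ?_
    rw [← Complex.conj_mul', hTn]
    simp only [he, map_mul, Complex.conj_ofReal]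
    ring
  rw [hsumS, greenForm_eq_kernelForm, Complex.norm_real, Real.norm_of_nonneg hSpos.le] at hbs
  set K := kernelForm w (Real.exp (-μ)) T with hK
  have hKq : 2 * μ * (‖T‖ ^ 2) ^ 2 ≤ K * q := by
    have := mul_le_mul_of_nonneg_left hbs (by positivity : (0 : ℝ) ≤ 2 * μ)
    refine this.trans_eq ?_
    rw [← hq]
    field_simp
  have hK0 : 0 ≤ K := by
    by_contra hcon
    have h1 : K * q < 0 := mul_neg_of_neg_of_pos (not_le.1 hcon) hq0
    have h2 : 0 ≤ 2 * μ * (‖T‖ ^ 2) ^ 2 := by positivity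
    linarith
  refine ⟨fun h => ?_, ?_⟩
  · rw [h] at hSpos
    simp at hSpos
  -- The energy q is eliminated between 2μ‖T‖⁴ ≤ K q and (2μ - δ) q ≤ 2μ‖T‖².
  · have h1 : 2 * μ * ‖T‖ ^ 2 * ((2 * μ - δ) * ‖T‖ ^ 2) ≤ 2 * μ * ‖T‖ ^ 2 * K := by
      calc _ = (2 * μ - δ) * (2 * μ * (‖T‖ ^ 2) ^ 2) := by ring
        _ ≤ (2 * μ - δ) * (K * q) := mul_le_mul_of_nonneg_left hKq (by linarith)
        _ = K * ((2 * μ - δ) * q) := by ring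
        _ ≤ K * (2 * μ * ‖T‖ ^ 2) := mul_le_mul_of_nonneg_left hqS' hK0
        _ = _ := by ring
    exact le_of_mul_le_mul_left h1 (by positivity)

theorem sum_sqrt_le_of_orthonormal (hV : Summable fun n => |V n|) (hΩ : IsOpen Ω)
    (hpts : ∀ n : ℕ+, ((n : ℕ) : ℝ) ∈ Ω) (hQ : ∀ p ∈ Q, IsRegular p) {ι : Type*} [Fintype ι]
    {E : ι → ℝ} (hE : ∀ i, E i < 0) {u : ι → L2 Ω} (ho : Orthonormal ℂ u)
    (hu : ∀ i, (u i, (E i : ℂ) • u i) ∈ formOperator Ω Q V) :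
    ∑ i, √|E i| ≤ 1 / 2 * ∑' n, |V n| := by
  choose g hg hug using hu
  set κ : ι → ℝ := fun i => √|E i| with hκ
  have hκ0 : ∀ i, 0 < κ i := fun i => Real.sqrt_pos.2 (abs_pos.2 (hE i).ne)
  have hκE : ∀ i, -κ i ^ 2 = E i := fun i => by
    rw [hκ, Real.sq_sqrt (abs_nonneg _), abs_of_neg (hE i), neg_neg]
  have hV' : Summable fun n : ℕ => |V n.succPNat| :=
    (Equiv.pnatEquivNat.symm.summable_iff (f := fun n => |V n|)).2 hV
  have hVt : ∑' n : ℕ, |V n.succPNat| = ∑' n, |V n| :=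
    Equiv.pnatEquivNat.symm.tsum_eq fun n => |V n|
  have htend : Tendsto (fun N => ∑' k : ℕ, |V (k + N).succPNat|) atTop (nhds 0) :=
    tendsto_sum_nat_add fun n => |V n.succPNat|
  let P : (ι → ℂ) →ₗ[ℂ] Q := Fintype.linearCombination ℂ fun i => (⟨(u i, g i), hg i⟩ : Q)
  have hPa : ∀ a, (P a).1 = ∑ i, a i • (u i, g i) := by
    intro a
    simp only [P, Fintype.linearCombination_apply]
    rw [Submodule.coe_sum]
    rfl
  have hPa0 : ∀ a, a ≠ 0 → (P a).1.1 ≠ 0 := by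
    intro a ha h
    rw [hPa, Prod.fst_sum] at h
    exact ha (funext (Fintype.linearIndependent_iff.1 ho.linearIndependent a h))
  -- The family is finite, so one N makes the tail smaller than every 2κ_i; the total error, a fixed
  -- multiple of the tail, vanishes as N → ∞.
  have key : ∀ᶠ N : ℕ in atTop,
      ∑ i, (2 * κ i - ∑' k : ℕ, |V (k + N).succPNat|) ≤ ∑' n, |V n| := by
    have hev : ∀ᶠ N : ℕ in atTop, ∀ i, ∑' k : ℕ, |V (k + N).succPNat| < 2 * κ i :=
      eventually_all.2 fun i => htend.eventually_lt_const (by linarith [hκ0 i])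
    filter_upwards [hev] with N hN
    refine (sum_le_sum_sq (fun n : Fin N => √|V (n : ℕ).succPNat|) κ _ (fun i => (hκ0 i).le)
      (evalMap hΩ hpts hQ (fun n : Fin N => √|V (n : ℕ).succPNat|) ∘ₗ P) fun i a ha hai => ?_).trans
      ?_
    · refine evalMap_ne_zero_and_le hΩ hpts hQ hV' N (hκ0 i) (hN i) (P a) (hPa0 a ha) ?_
      have h := energy_le hV hΩ hpts hQ (κ := κ) (p := fun i => (u i, g i)) hg
        (fun i q hq => by rw [hκE]; exact hug i q hq) ho (hκ0 i).le a hai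
      rw [← hPa] at h
      refine h.trans_eq ?_
      exact (Equiv.pnatEquivNat.symm.tsum_eq fun n : ℕ+ =>
        |V n| * ‖contRep Ω (P a).1.1 (n : ℕ)‖ ^ 2).symm
    · simp only [Real.sq_sqrt (abs_nonneg _)]
      rw [Fin.sum_univ_eq_sum_range fun n => |V n.succPNat|, ← hVt]
      exact hV'.sum_le_tsum _ fun _ _ => abs_nonneg _
  have hlim : Tendsto (fun N : ℕ => ∑ i, (2 * κ i - ∑' k : ℕ, |V (k + N).succPNat|)) atTop
      (nhds (∑ i, (2 * κ i - 0))) :=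
    tendsto_finsetSum _ fun i _ => tendsto_const_nhds.sub htend
  have := le_of_tendsto hlim key
  simp only [sub_zero, ← Finset.mul_sum] at this
  linarith

theorem exists_orthonormal_of_le_rank {X : Type*} [NormedAddCommGroup X] [InnerProductSpace ℂ X]
    {W : Submodule ℂ X} {m : ℕ} (h : (m : Cardinal) ≤ Module.rank ℂ W) :
    ∃ f : Fin m → X, Orthonormal ℂ f ∧ ∀ i, f i ∈ W := by
  obtain ⟨s, hs, hli⟩ := le_rank_iff_exists_linearIndependent_finset.1 h
  let b : Fin m → W := fun i => (s.equivFin.symm (Fin.cast hs.symm i)).1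
  have hb : LinearIndependent ℂ b :=
    hli.comp (fun i => s.equivFin.symm (Fin.cast hs.symm i))
      (s.equivFin.symm.injective.comp (Fin.cast_injective _))
  have ho := InnerProductSpace.gramSchmidtNormed_orthonormal hb
  exact ⟨fun i => (InnerProductSpace.gramSchmidtNormed ℂ b i : W),
    ho.comp_linearIsometry W.subtypeₗᵢ, fun i => Subtype.prop _⟩

/-- Stated for natural numbers m below the multiplicities because these are not yet known to be
finite; finiteness follows from this bound with arbitrary m. -/
theorem sum_mul_sqrt_le (hV : Summable fun n => |V n|) (hΩ : IsOpen Ω)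
    (hpts : ∀ n : ℕ+, ((n : ℕ) : ℝ) ∈ Ω) (hQ : ∀ p ∈ Q, IsRegular p) (s : Finset ℝ)
    (hs : ∀ E ∈ s, E < 0) (m : ℝ → ℕ)
    (hm : ∀ E ∈ s, (m E : ℕ∞) ≤ multiplicity (formOperator Ω Q V) E) :
    ∑ E ∈ s, m E * √|E| ≤ 1 / 2 * ∑' n, |V n| := by
  have hex : ∀ E : s, ∃ f : Fin (m E) → L2 Ω, Orthonormal ℂ f ∧
      ∀ i, (f i, ((E : ℝ) : ℂ) • f i) ∈ formOperator Ω Q V := by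
    intro E
    have h := hm E E.2
    have hspan : Submodule.span ℂ {u : L2 Ω | (u, ((E : ℝ) : ℂ) • u) ∈ formOperator Ω Q V} =
        eigenspace hV hΩ hpts hQ E := Submodule.span_eq (eigenspace hV hΩ hpts hQ E)
    rw [multiplicity, hspan, Cardinal.natCast_le_toENat] at h
    exact exists_orthonormal_of_le_rank h
  choose f hf hfE using hex
  have ho : Orthonormal ℂ fun i : Σ E : s, Fin (m E) => f i.1 i.2 := by
    classical
    rw [orthonormal_iff_ite]
    rintro ⟨E, i⟩ ⟨F, j⟩
    by_cases hEF : E = F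
    · subst hEF
      have := orthonormal_iff_ite.1 (hf E) i j
      simpa using this
    · rw [if_neg fun h => hEF (congrArg Sigma.fst h)]
      exact inner_eq_zero_of_ne (fun h => hEF (Subtype.ext h)) (hfE E i) (hfE F j)
  have := sum_sqrt_le_of_orthonormal hV hΩ hpts hQ (E := fun i : Σ E : s, Fin (m E) => (i.1 : ℝ))
    (fun i => hs _ i.1.2) ho fun i => hfE i.1 i.2
  rw [Fintype.sum_sigma] at this
  simp only [Finset.sum_const, Finset.card_univ, Fintype.card_fin, nsmul_eq_mul] at this
  rwa [Finset.sum_coe_sort s fun E => m E * √|E|] at this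

theorem multiplicity_ne_top (hV : Summable fun n => |V n|) (hΩ : IsOpen Ω)
    (hpts : ∀ n : ℕ+, ((n : ℕ) : ℝ) ∈ Ω) (hQ : ∀ p ∈ Q, IsRegular p) {E : ℝ} (hE : E < 0) :
    multiplicity (formOperator Ω Q V) E ≠ ⊤ := by
  intro htop
  have hpos : 0 < √|E| := Real.sqrt_pos.2 (abs_pos.2 hE.ne)
  obtain ⟨m, hm⟩ := exists_nat_gt ((1 / 2 * ∑' n, |V n|) / √|E|)
  have := sum_mul_sqrt_le hV hΩ hpts hQ {E} (by simpa using hE) (fun _ => m) (by simp [htop])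
  rw [Finset.sum_singleton] at this
  rw [div_lt_iff₀ hpos] at hm
  linarith

theorem sumSqrtNegEigenvalues_formOperator_le (hV : Summable fun n => |V n|) (hΩ : IsOpen Ω)
    (hpts : ∀ n : ℕ+, ((n : ℕ) : ℝ) ∈ Ω) (hQ : ∀ p ∈ Q, IsRegular p) :
    sumSqrtNegEigenvalues (formOperator Ω Q V) ≤ ENNReal.ofReal (1 / 2 * ∑' n, |V n|) := by
  classical
  rw [sumSqrtNegEigenvalues, ENNReal.tsum_eq_iSup_sum]
  refine iSup_le fun s => ?_
  set m : ℝ → ℕ := fun E => (multiplicity (formOperator Ω Q V) E).toNat with hm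
  -- `toNat` sends ⊤ to 0, so finiteness is what keeps an infinite multiplicity from being dropped.
  have hmE : ∀ E : ℝ, E < 0 → (m E : ℕ∞) = multiplicity (formOperator Ω Q V) E := fun E hE =>
    ENat.natCast_toNat (multiplicity_ne_top hV hΩ hpts hQ hE)
  have h := sum_mul_sqrt_le hV hΩ hpts hQ (s.map (Function.Embedding.subtype _))
    (fun E hE => by
      obtain ⟨F, -, rfl⟩ := Finset.mem_map.1 hE
      exact F.2.1) m
    (fun E hE => by
      obtain ⟨F, -, rfl⟩ := Finset.mem_map.1 hE
      exact (hmE _ F.2.1).le)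
  rw [Finset.sum_map] at h
  refine le_trans (le_of_eq ?_) (ENNReal.ofReal_le_ofReal h)
  rw [ENNReal.ofReal_sum_of_nonneg fun E _ => by positivity]
  refine Finset.sum_congr rfl fun E _ => ?_
  rw [← hmE _ E.2.1, ENNReal.ofReal_mul (Nat.cast_nonneg _), ENNReal.ofReal_natCast]
  rfl

end EigenvalueBound

end DeltaSchrodinger

end

theorem theorem2 (V : ℕ+ → ℝ) (hV : Summable (fun n : ℕ+ => |V n|)) :
    DeltaSchrodinger.sumSqrtNegEigenvalues (DeltaSchrodinger.halfLineOperator V) ≤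
        ENNReal.ofReal ((1 / 2) * ∑' n : ℕ+, |V n|) ∧
      DeltaSchrodinger.sumSqrtNegEigenvalues (DeltaSchrodinger.lineOperator V) ≤
        ENNReal.ofReal ((1 / 2) * ∑' n : ℕ+, |V n|) :=
  ⟨DeltaSchrodinger.sumSqrtNegEigenvalues_formOperator_le hV isOpen_Ioi
      (fun n => Set.mem_Ioi.2 (Nat.cast_pos.2 n.pos))
      fun _ hp => DeltaSchrodinger.isRegular_of_mem_sobolevW0 measurableSet_Ioi hp,
    DeltaSchrodinger.sumSqrtNegEigenvalues_formOperator_le hV isOpen_univ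
      (fun _ => Set.mem_univ _) fun _ hp => DeltaSchrodinger.isRegular_of_mem_sobolevW hp⟩
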